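/- Let $\mathcal{S}$ (states), $\mathcal{A}^1$, $\mathcal{A}^2$ (actions of Players 1 and 2) be finite sets, and let $\emptyset\neq\mathcal{A}^i(s)\subseteq\mathcal{A}^i$ be the actions available to Player $i$ in state $s$. At each time $t=0,1,2,\dots$ both players simultaneously choose actions $a^i_t\in\mathcal{A}^i(s_t)$ at random, independently given the history $h_t=s_0a^1_0a^2_0\dots s_{t-1}a^1_{t-1}a^2_{t-1}s_t$, and the next state is $s_{t+1}$ with probability $\mathcal{P}(s_t,a^1_t,a^2_t,s_{t+1})$. A policy $\pi^i\in\Pi^i$ of Player $i$ assigns to each history $h_t$ a probability distribution on $\mathcal{A}^i(s_t)$. Let $s_0$ be the initial state and $\mathcal{S}^R\subseteq\mathcal{S}$ the set of winning states, each of which is absorbing. Let $\pi^{\mathsf{Av}}$ be a stationary policy of Player 1 (the average player): $\pi^{\mathsf{Av}}(s,\cdot)$ is a probability distribution on $\mathcal{A}^1(s)$ for each $s$. Let $\Gamma^{\pi^1,\pi^2}$ be the law of the infinite run $s_0a^1_0a^2_0s_1a^1_1a^2_1\dots$ from $s_0$, let $\Pr^{\pi^1,\pi^2}(\lozenge C\mid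 s)$ be the probability that the run started in $s$ ever visits $C$ (time $0$ included), and write $KL(\pi^1,\pi^2\|\pi^{\mathsf{Av}},\pi^2)\in[0,\infty]$ for the Kullback–Leibler divergence of $\Gamma^{\pi^1,\pi^2}$ from $\Gamma^{\pi^{\mathsf{Av}},\pi^2}$. Define $$S^{trap}=\{s:\ \exists\,\pi^2\in\Pi^2,\ \Pr\nolimits^{\pi^{\mathsf{Av}},\pi^2}(\lozenge\mathcal{S}^R\mid s)=0\},$$ $$S^{+}=\{s:\ \exists\,\pi^1\in\Pi^1\ \forall\,\pi^2\in\Pi^2,\ \Pr\nolimits^{\pi^1,\pi^2}(\lozenge\mathcal{S}^R\mid s)=1\text{ and }\Pr\nolimits^{\pi^1,\pi^2}(\lozenge S^{trap}\mid s)=0\}.$$ (1) Assume that $\pi^{\mathsf{Av}}(s,a)>0$ for all $s\in\mathcal{S}$ and $a\in\mathcal{A}^1(s)$. If $s_0\in S^{+}$, then there is a policy $\pi^{1,fin}\in\Pi^1$ such that, for every $\pi^2\in\Pi^2$, $KL(\pi^{1,fin},\pi^2\|\pi^{\mathsf{Av}},\pi^2)<\infty$ and $\sum_{t=0}^\infty\Pr^{\pi^{1,fin},\pi^2}(s_t=s\mid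 s_0)<\infty$ for all $s\in S^{+}\setminus\mathcal{S}^R$. (2) For all $\pi^{1,inf}\in\Pi^1$ and $\pi^2\in\Pi^2$: if $\sum_{t=0}^\infty\Pr^{\pi^{1,inf},\pi^2}(s_t=s\mid s_0)=\infty$ for some $s\in S^{+}\setminus\mathcal{S}^R$, then $KL(\pi^{1,inf},\pi^2\|\pi^{\mathsf{Av}},\pi^2)=\infty$. -/

import Mathlib

open MeasureTheory ProbabilityTheory
open scoped ENNReal

noncomputable section

/-- What happens at one time step: the current state, and the actions that the two players choose
simultaneously in it. -/
@[ext]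
structure GameStep (S A B : Type*) where
  /-- the state -/
  state : S
  /-- the action of Player 1 -/
  act1 : A
  /-- the action of Player 2 -/
  act2 : B

namespace GameStep

variable {S A B : Type*}

instance : MeasurableSpace (GameStep S A B) := ⊤

instance : DiscreteMeasurableSpace (GameStep S A B) := ⟨fun _ => trivial⟩

instance [Finite S] [Finite A] [Finite B] : Finite (GameStep S A B) :=
  Finite.of_injective (fun x => (x.state, x.act1, x.act2)) (by
    rintro ⟨s, a, b⟩ ⟨s', a', b'⟩ h
    simpa using h)

end GameStep

/-- An identity concealment game: a two-player stochastic reachability game with absorbing winning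
states, together with a stationary policy of the average player. The transition distribution
`P s a b` matters only for actions `a ∈ A1 s` and `b ∈ A2 s`. -/
structure ICGame (S A B : Type*) where
  /-- the actions available to Player 1 in a state -/
  A1 : S → Set A
  /-- the actions available to Player 2 in a state -/
  A2 : S → Set B
  A1_nonempty : ∀ s, (A1 s).Nonempty
  A2_nonempty : ∀ s, (A2 s).Nonempty
  /-- the transition probabilities -/
  P : S → A → B → PMF S
  /-- the initial state -/
  s₀ : S
  /-- the winning states of Player 1 -/
  SR : Set S
  absorbing : ∀ s ∈ SR, ∀ a ∈ A1 s, ∀ b ∈ A2 s, P s a b = PMF.pure s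
  /-- the stationary policy of the average player -/
  av : S → PMF A
  av_mem : ∀ s, (av s).support ⊆ A1 s

/-- A (history-dependent, randomized) policy with available actions `avail`. The history
`h_t = s_0 a_0 b_0 … s_{t-1} a_{t-1} b_{t-1} s_t` is given by the list, in chronological order and
of length `t`, of the steps before time `t`, and by the current state `s_t`. -/
structure GamePolicy (S A B : Type*) {C : Type*} (avail : S → Set C) where
  /-- the distribution of the next action, given the past and the current state -/
  act : List (GameStep S A B) → S → PMF C
  act_mem : ∀ past s, (act past s).support ⊆ avail s

namespace ICGame

variable {S A B : Type*} (G : ICGame S A B)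

/-- The set `Π¹` of policies of Player 1. -/
abbrev Policy1 : Type _ := GamePolicy S A B G.A1

/-- The set `Π²` of policies of Player 2. -/
abbrev Policy2 : Type _ := GamePolicy S A B G.A2

/-- The average player's stationary policy as a policy of Player 1. -/
def avPolicy : G.Policy1 where
  act _ s := G.av s
  act_mem _ s := G.av_mem s

/-- All actions available to Player 1 are permissible: the average player takes each of them with
positive probability. -/
def AllPermissible : Prop := ∀ s, ∀ a ∈ G.A1 s, 0 < G.av s a

/-- The distribution of the step `(s, a, b)` that is played in the state `s` after `past`: the
two players choose their actions independently. -/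
def stepAt (π₁ : G.Policy1) (π₂ : G.Policy2) (past : List (GameStep S A B)) (s : S) :
    PMF (GameStep S A B) :=
  (π₁.act past s).bind fun a => (π₂.act past s).map fun b => ⟨s, a, b⟩

/-- The distribution of the step at time `n + 1`, given the steps at the times `0, …, n`. -/
def nextStep (π₁ : G.Policy1) (π₂ : G.Policy2) (n : ℕ)
    (x : (i : Finset.Iic n) → GameStep S A B) : PMF (GameStep S A B) :=
  let last := x ⟨n, Finset.mem_Iic.2 le_rfl⟩
  (G.P last.state last.act1 last.act2).bind fun s =>
    G.stepAt π₁ π₂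
      (List.ofFn fun i : Fin (n + 1) => x ⟨i, Finset.mem_Iic.2 (Nat.lt_succ_iff.1 i.isLt)⟩) s

variable [Finite S] [Finite A] [Finite B]

/-- `nextStep` as a probability kernel. -/
def kernel (π₁ : G.Policy1) (π₂ : G.Policy2) (n : ℕ) :
    Kernel ((i : Finset.Iic n) → GameStep S A B) (GameStep S A B) :=
  Kernel.ofFunOfCountable fun x => (G.nextStep π₁ π₂ n x).toMeasure

instance (π₁ : G.Policy1) (π₂ : G.Policy2) (n : ℕ) : IsMarkovKernel (G.kernel π₁ π₂ n) :=
  ⟨fun x => PMF.toMeasure.isProbabilityMeasure (G.nextStep π₁ π₂ n x)⟩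

/-- The law of the infinite run that starts in the state `s`, under the policies `π₁` and `π₂`. -/
def runLaw (π₁ : G.Policy1) (π₂ : G.Policy2) (s : S) : Measure (ℕ → GameStep S A B) :=
  Kernel.trajMeasure (X := fun _ => GameStep S A B)
    (G.stepAt π₁ π₂ [] s).toMeasure (G.kernel π₁ π₂)

/-- The probability of eventually reaching the set `C` from the state `s`. -/
def reachProb (π₁ : G.Policy1) (π₂ : G.Policy2) (C : Set S) (s : S) : ℝ≥0∞ :=
  G.runLaw π₁ π₂ s {γ | ∃ t, (γ t).state ∈ C}

/-- The trap states: Player 2 has a policy against which the average player never wins. -/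
def trap : Set S := {s | ∃ π₂ : G.Policy2, G.reachProb G.avPolicy π₂ G.SR s = 0}

/-- The set `S⁺` of potentially winning states: Player 1 has a policy that, against every policy of
Player 2, reaches the winning states with probability one and (almost surely) avoids the trap
states. -/
def potentiallyWinning : Set S :=
  {s | ∃ π₁ : G.Policy1, ∀ π₂ : G.Policy2,
    G.reachProb π₁ π₂ G.SR s = 1 ∧ G.reachProb π₁ π₂ G.trap s = 0}

/-- The expected time `∑ₜ Pr(s_t = s | s_0)` that is spent in the state `s`. -/
def expectedTime (π₁ : G.Policy1) (π₂ : G.Policy2) (s : S) : ℝ≥0∞ :=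
  ∑' t : ℕ, G.runLaw π₁ π₂ G.s₀ {γ | (γ t).state = s}

/-- The objective `KL(π₁, π₂ ‖ π^Av, π₂)`: the Kullback–Leibler divergence between the laws of runs
from the initial state. -/
def klObjective (π₁ : G.Policy1) (π₂ : G.Policy2) : ℝ≥0∞ :=
  InformationTheory.klDiv (G.runLaw π₁ π₂ G.s₀) (G.runLaw G.avPolicy π₂ G.s₀)

end ICGame

end

/-! Both parts rest on an exponential moment for the time spent in a region `D`. Suppose that every
nonempty `Z ⊆ D` contains a state from which, whatever Player 2 does, the play has a positive chance
to go to a target `T` or to `D \ Z`. Attractor ranks `r` then give `h = 2 - c ^ r` on `T ∪ D`, whose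
mean shrinks by a factor `θ > 1` at each step from `D` (`exists_drift`). Hence the mean of `θ ^
visits` is at most 2, uniformly in Player 2's policy and in the horizon (`lintegral_pow_visits_le`).

Part (2): apply this to the average player, with `D` the states that are neither winning nor trap.
If Player 2 could keep the average player in the union of some `Z ⊆ D` and the trap, then `Z` would
consist of trap states. The Fenchel inequality for `klFun` bounds `log θ` times the mean number of
visits under the first law by the divergence plus the exponential moment under the second. A finite
divergence thus forces a finite expected time in `D`, which contains `S⁺ \ SR`.

Part (1): until the first win, Player 1 mixes all actions that keep the play in `S⁺`, and then
imitates the average player. Here `D = S⁺ \ SR`: if Player 2 could confine these actions to a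
subset, no winning policy could exist there, since winning policies use no other actions
(`exists_stayActions_escape`). So the time to win has finite mean. A win at time `n` costs a
likelihood ratio of at most `c ^ n`, so the divergence is at most `1 + log c` times that mean.

Policies depend on the history, so arguments by induction on time run through the continuation
policy `after` and the decomposition `runLaw_eq_sum` over the first step. -/

/-- The policy that remains after the step `x` has been played. -/
def GamePolicy.after {S A B C : Type*} {avail : S → Set C} (π : GamePolicy S A B avail)
    (x : GameStep S A B) : GamePolicy S A B avail where
  act past s := π.act (x :: past) s
  act_mem past s := π.act_mem (x :: past) s

/-- The run that starts with the step `x` and goes on with `γ`. -/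
def consRun {X : Type*} (x : X) (γ : ℕ → X) : ℕ → X
  | 0 => x
  | n + 1 => γ n

@[simp] lemma consRun_zero {X : Type*} (x : X) (γ : ℕ → X) : consRun x γ 0 = x := rfl

lemma measurable_consRun {X : Type*} [MeasurableSpace X] (x : X) :
    Measurable (consRun x) := by
  refine measurable_pi_iff.2 fun n => ?_
  cases n with
  | zero => exact measurable_const
  | succ n => exact measurable_pi_apply n

/-- The runs that agree with `γ` up to time `n`. -/
def runCylinder {X : Type*} (n : ℕ) (γ : ℕ → X) : Set (ℕ → X) := {ω | ∀ i ≤ n, ω i = γ i}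

lemma runCylinder_eq_preimage {X : Type*} (n : ℕ) (γ : ℕ → X) :
    runCylinder n γ =
      Preorder.frestrictLe (π := fun _ => X) n ⁻¹' {Preorder.frestrictLe (π := fun _ => X) n γ} := by
  ext ω
  simp only [runCylinder, Set.mem_ofPred_eq, Set.mem_preimage, Set.mem_singleton_iff, funext_iff,
    Subtype.forall, Finset.mem_Iic, Preorder.frestrictLe_apply]

lemma measurableSet_runCylinder {X : Type*} [MeasurableSpace X] [MeasurableSingletonClass X]
    (n : ℕ) (γ : ℕ → X) : MeasurableSet (runCylinder n γ) := by
  rw [runCylinder_eq_preimage]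
  exact (Preorder.measurable_frestrictLe n) (measurableSet_singleton _)

/-- Finite measures on runs that agree on cylinders are equal. -/
lemma Measure.ext_of_runCylinder {X : Type*} [MeasurableSpace X] [MeasurableSingletonClass X]
    [Finite X] {μ ν : Measure (ℕ → X)} [IsFiniteMeasure μ] [IsFiniteMeasure ν]
    (h : ∀ n γ, μ (runCylinder n γ) = ν (runCylinder n γ)) : μ = ν := by
  have key : ∀ n, μ.map (Preorder.frestrictLe (π := fun _ => X) n) =
      ν.map (Preorder.frestrictLe (π := fun _ => X) n) := by
    intro n
    refine Measure.ext_of_singleton fun x => ?_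
    rw [Measure.map_apply (Preorder.measurable_frestrictLe n) (measurableSet_singleton _),
      Measure.map_apply (Preorder.measurable_frestrictLe n) (measurableSet_singleton _)]
    -- A finite history extends to an infinite run by repeating its last entry.
    have hx : Preorder.frestrictLe (π := fun _ => X) n (fun i => x ⟨min i n, by simp⟩) = x := by
      funext i
      have := Finset.mem_Iic.1 i.2
      simp only [Preorder.frestrictLe_apply]
      congr 1
      exact Subtype.ext (min_eq_left this)
    rw [← hx, ← runCylinder_eq_preimage]
    exact h _ _
  refine IsProjectiveLimit.unique (P := fun I => μ.map I.restrict) (fun I => rfl) fun I => ?_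
  have hI : I ⊆ Finset.Iic (I.sup id) := fun i hi => Finset.mem_Iic.2 (Finset.le_sup (f := id) hi)
  have hr : (I.restrict : (ℕ → X) → _) =
      Finset.restrict₂ (π := fun _ => X) hI ∘ Preorder.frestrictLe (π := fun _ => X) (I.sup id) :=
    rfl
  have hm (ρ : Measure (ℕ → X)) : ρ.map I.restrict =
      (ρ.map (Preorder.frestrictLe (π := fun _ => X) (I.sup id))).map
        (Finset.restrict₂ (π := fun _ => X) hI) := by
    rw [hr, Measure.map_map (Finset.measurable_restrict₂ _) (Preorder.measurable_frestrictLe _)]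
  change ν.map I.restrict = μ.map I.restrict
  rw [hm, hm, key]

/-! ### Probabilities of cylinders -/

namespace ICGame

variable {S A B : Type*} (G : ICGame S A B)

open Classical in
lemma stepAt_apply (π₁ : G.Policy1) (π₂ : G.Policy2) (past : List (GameStep S A B)) (s : S)
    (x : GameStep S A B) : G.stepAt π₁ π₂ past s x =
      if x.state = s then π₁.act past s x.act1 * π₂.act past s x.act2 else 0 := by
  have h : ∀ a, ((π₂.act past s).map fun b => (⟨s, a, b⟩ : GameStep S A B)) x =
      if x.state = s ∧ x.act1 = a then π₂.act past s x.act2 else 0 := by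
    intro a
    rw [PMF.map_apply]
    split_ifs with hx
    · rw [tsum_eq_single x.act2]
      · have h : x = ⟨s, a, x.act2⟩ := GameStep.ext hx.1 hx.2 rfl
        rw [if_pos h]
      · intro b hb
        rw [if_neg]
        rintro rfl
        exact hb rfl
    · refine ENNReal.tsum_eq_zero.2 fun b => if_neg ?_
      rintro rfl
      exact hx ⟨rfl, rfl⟩
  rw [stepAt, PMF.bind_apply]
  simp_rw [h]
  split_ifs with hx
  · rw [tsum_eq_single x.act1]
    · simp [hx]
    · intro a ha
      simp [ha.symm]
  · simp [hx]

lemma stepAt_apply_of_ne (π₁ : G.Policy1) (π₂ : G.Policy2) (past : List (GameStep S A B)) {s : S}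
    {x : GameStep S A B} (h : x.state ≠ s) : G.stepAt π₁ π₂ past s x = 0 := by
  classical
  rw [stepAt_apply, if_neg h]

lemma nextStep_apply (π₁ : G.Policy1) (π₂ : G.Policy2) (n : ℕ) (γ : ℕ → GameStep S A B)
    (y : GameStep S A B) :
    G.nextStep π₁ π₂ n (Preorder.frestrictLe (π := fun _ => GameStep S A B) n γ) y =
      G.P (γ n).state (γ n).act1 (γ n).act2 y.state *
        G.stepAt π₁ π₂ (List.ofFn fun i : Fin (n + 1) => γ i) y.state y := by
  rw [nextStep, PMF.bind_apply, tsum_eq_single y.state]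
  · rfl
  · intro s hs
    rw [stepAt_apply_of_ne _ _ _ _ hs.symm, mul_zero]

variable [Finite S] [Finite A] [Finite B]

instance (π₁ : G.Policy1) (π₂ : G.Policy2) (s : S) : IsProbabilityMeasure (G.runLaw π₁ π₂ s) := by
  unfold runLaw
  infer_instance

lemma runLaw_runCylinder_zero (π₁ : G.Policy1) (π₂ : G.Policy2) (s : S)
    (γ : ℕ → GameStep S A B) :
    G.runLaw π₁ π₂ s (runCylinder 0 γ) = G.stepAt π₁ π₂ [] s (γ 0) := by
  rw [runCylinder_eq_preimage,
    ← Measure.map_apply (Preorder.measurable_frestrictLe 0) (measurableSet_singleton _), runLaw,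
    Kernel.trajMeasure, Measure.map_comp _ _ (Preorder.measurable_frestrictLe 0),
    Kernel.traj_map_frestrictLe, Kernel.partialTraj_self, Measure.id_comp,
    Measure.map_apply (by fun_prop) (measurableSet_singleton _)]
  rw [← PMF.toMeasure_apply_singleton _ _ (measurableSet_singleton _)]
  congr 1
  ext x
  simp only [Set.mem_preimage, Set.mem_singleton_iff]
  constructor
  · intro h
    exact congrFun h ⟨0, by simp⟩
  · intro h
    funext i
    obtain ⟨i, hi⟩ := i
    obtain rfl : i = 0 := by simpa using hi
    exact h

/-- The trajectory measure on times up to `n + 1` is the composition product of its marginal up to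
`n` with the kernel; evaluate this on a product of singletons. -/
lemma runLaw_runCylinder_succ (π₁ : G.Policy1) (π₂ : G.Policy2) (s : S) (n : ℕ)
    (γ : ℕ → GameStep S A B) :
    G.runLaw π₁ π₂ s (runCylinder (n + 1) γ) = G.runLaw π₁ π₂ s (runCylinder n γ) *
      (G.P (γ n).state (γ n).act1 (γ n).act2 (γ (n + 1)).state *
        G.stepAt π₁ π₂ (List.ofFn fun i : Fin (n + 1) => γ i) (γ (n + 1)).state (γ (n + 1))) := by
  have h := Kernel.map_frestrictLe_trajMeasure_compProd_eq_map_trajMeasure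
    (X := fun _ => GameStep S A B) (μ₀ := (G.stepAt π₁ π₂ [] s).toMeasure)
    (κ := G.kernel π₁ π₂) (a := n)
  have h2 := congrArg (fun μ => μ ({Preorder.frestrictLe (π := fun _ => GameStep S A B) n γ} ×ˢ
    {γ (n + 1)})) h
  beta_reduce at h2
  rw [Measure.compProd_apply_prod (measurableSet_singleton _) (measurableSet_singleton _),
    Measure.restrict_singleton, lintegral_smul_measure, lintegral_dirac,
    Measure.map_apply (Preorder.measurable_frestrictLe n) (measurableSet_singleton _),
    ← runCylinder_eq_preimage, Measure.map_apply (by fun_prop)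
      ((measurableSet_singleton _).prod (measurableSet_singleton _))] at h2
  have h3 : (fun x : ℕ → GameStep S A B =>
      (Preorder.frestrictLe (π := fun _ => GameStep S A B) n x, x (n + 1))) ⁻¹'
      ({Preorder.frestrictLe (π := fun _ => GameStep S A B) n γ} ×ˢ {γ (n + 1)}) =
      runCylinder (n + 1) γ := by
    ext ω
    have h4 : Preorder.frestrictLe (π := fun _ => GameStep S A B) n ω =
        Preorder.frestrictLe (π := fun _ => GameStep S A B) n γ ↔ ω ∈ runCylinder n γ := by
      rw [runCylinder_eq_preimage]; rfl
    simp only [Set.mem_preimage, Set.mem_prod, Set.mem_singleton_iff]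
    rw [h4]
    simp only [runCylinder, Set.mem_ofPred_eq]
    constructor
    · rintro ⟨h5, h6⟩ i hi
      rcases Nat.le_succ_iff.1 hi with h7 | rfl
      exacts [h5 i h7, h6]
    · exact fun h5 => ⟨fun i hi => h5 i (by omega), h5 _ le_rfl⟩
  rw [h3] at h2
  rw [← nextStep_apply]
  refine h2.symm.trans ?_
  rw [smul_eq_mul]
  congr 1
  exact PMF.toMeasure_apply_singleton _ _ (measurableSet_singleton _)

end ICGame

/-! ### Decomposition over the first step, and invariants -/

namespace ICGame

variable {S A B : Type*} (G : ICGame S A B)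

/-- The probability that, in the state `s`, the actions `i.1`, `i.2.1` are played and lead to the
state `i.2.2`. -/
noncomputable def stepWeight (π₁ : G.Policy1) (π₂ : G.Policy2) (s : S) (i : A × B × S) : ℝ≥0∞ :=
  π₁.act [] s i.1 * π₂.act [] s i.2.1 * G.P s i.1 i.2.1 i.2.2

lemma tsum_stepWeight (π₁ : G.Policy1) (π₂ : G.Policy2) (s : S) :
    ∑' i, G.stepWeight π₁ π₂ s i = 1 := by
  rw [ENNReal.tsum_prod']
  simp_rw [ENNReal.tsum_prod', stepWeight, ENNReal.tsum_mul_left, PMF.tsum_coe, mul_one,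
    ENNReal.tsum_mul_left, PMF.tsum_coe, mul_one, PMF.tsum_coe]

lemma stepWeight_ne_zero {π₁ : G.Policy1} {π₂ : G.Policy2} {s : S} {i : A × B × S} :
    G.stepWeight π₁ π₂ s i ≠ 0 ↔ i.1 ∈ (π₁.act [] s).support ∧ i.2.1 ∈ (π₂.act [] s).support ∧
      i.2.2 ∈ (G.P s i.1 i.2.1).support := by
  simp [stepWeight, PMF.mem_support_iff, and_assoc]

lemma measurableSet_state (C : Set S) (t : ℕ) :
    MeasurableSet {γ : ℕ → GameStep S A B | (γ t).state ∈ C} :=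
  (measurable_pi_apply t : Measurable fun γ : ℕ → GameStep S A B => γ t)
    (MeasurableSet.of_discrete (s := {x : GameStep S A B | x.state ∈ C}))

variable [Finite S] [Finite A] [Finite B]

/-- This peels off the first step instead of the last. The induction works because prepending `γ 0`
to the history is exactly what `after` does. -/
lemma runLaw_runCylinder_succ' (π₁ : G.Policy1) (π₂ : G.Policy2) (s : S) (n : ℕ)
    (γ : ℕ → GameStep S A B) :
    G.runLaw π₁ π₂ s (runCylinder (n + 1) γ) =
      G.stepAt π₁ π₂ [] s (γ 0) * G.P (γ 0).state (γ 0).act1 (γ 0).act2 (γ 1).state *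
        G.runLaw (π₁.after (γ 0)) (π₂.after (γ 0)) (γ 1).state
          (runCylinder n fun k => γ (k + 1)) := by
  induction n with
  | zero =>
    rw [runLaw_runCylinder_succ, runLaw_runCylinder_zero, runLaw_runCylinder_zero, ← mul_assoc]
    rfl
  | succ n ih =>
    rw [runLaw_runCylinder_succ, ih, runLaw_runCylinder_succ, List.ofFn_succ]
    simp only [mul_assoc]
    rfl

lemma runLaw_runCylinder_of_ne (π₁ : G.Policy1) (π₂ : G.Policy2) {s : S} (n : ℕ)
    {γ : ℕ → GameStep S A B} (h : (γ 0).state ≠ s) :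
    G.runLaw π₁ π₂ s (runCylinder n γ) = 0 := by
  refine measure_mono_null (t := runCylinder 0 γ) (fun ω hω i hi => hω i (by omega)) ?_
  rw [runLaw_runCylinder_zero, stepAt_apply_of_ne _ _ _ _ h]

lemma preimage_consRun_runCylinder_of_ne {X : Type*} {x : X} {n : ℕ} {γ : ℕ → X} (h : x ≠ γ 0) :
    consRun x ⁻¹' runCylinder n γ = ∅ := by
  ext ω
  simp only [Set.mem_preimage, Set.mem_empty_iff_false, iff_false]
  exact fun h' => h (h' 0 (Nat.zero_le n))

lemma preimage_consRun_runCylinder_zero {X : Type*} (γ : ℕ → X) :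
    consRun (γ 0) ⁻¹' runCylinder 0 γ = Set.univ := by
  ext ω
  simp only [Set.mem_preimage, Set.mem_univ, iff_true]
  intro i hi
  obtain rfl : i = 0 := by omega
  rfl

lemma preimage_consRun_runCylinder_succ {X : Type*} (n : ℕ) (γ : ℕ → X) :
    consRun (γ 0) ⁻¹' runCylinder (n + 1) γ = runCylinder n fun k => γ (k + 1) := by
  ext ω
  constructor
  · intro h i hi
    exact h (i + 1) (by omega)
  · intro h i hi
    cases i with
    | zero => rfl
    | succ i => exact h i (by omega)

/-- The law of the run after the first step and transition. -/
noncomputable def tailLaw (π₁ : G.Policy1) (π₂ : G.Policy2) (s : S) (i : A × B × S) :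
    Measure (ℕ → GameStep S A B) :=
  G.runLaw (π₁.after ⟨s, i.1, i.2.1⟩) (π₂.after ⟨s, i.1, i.2.1⟩) i.2.2

instance (π₁ : G.Policy1) (π₂ : G.Policy2) (s : S) (i : A × B × S) :
    IsProbabilityMeasure (G.tailLaw π₁ π₂ s i) := by
  unfold tailLaw
  infer_instance

/-- The law of a run is a mixture over its first step and transition. -/
theorem runLaw_eq_sum (π₁ : G.Policy1) (π₂ : G.Policy2) (s : S) :
    G.runLaw π₁ π₂ s = Measure.sum fun i : A × B × S =>
      G.stepWeight π₁ π₂ s i • (G.tailLaw π₁ π₂ s i).map (consRun ⟨s, i.1, i.2.1⟩) := by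
  have happ : ∀ E : Set (ℕ → GameStep S A B), MeasurableSet E →
      (Measure.sum fun i : A × B × S => G.stepWeight π₁ π₂ s i •
        (G.tailLaw π₁ π₂ s i).map (consRun ⟨s, i.1, i.2.1⟩)) E =
      ∑' i, G.stepWeight π₁ π₂ s i *
        G.tailLaw π₁ π₂ s i (consRun ⟨s, i.1, i.2.1⟩ ⁻¹' E) := by
    intro E hE
    rw [Measure.sum_apply _ hE]
    refine tsum_congr fun i => ?_
    rw [Measure.smul_apply, smul_eq_mul, Measure.map_apply (measurable_consRun _) hE]
  have : IsFiniteMeasure (Measure.sum fun i : A × B × S => G.stepWeight π₁ π₂ s i •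
        (G.tailLaw π₁ π₂ s i).map (consRun ⟨s, i.1, i.2.1⟩)) := by
    constructor
    rw [happ _ MeasurableSet.univ]
    simp only [Set.preimage_univ, measure_univ, mul_one, tsum_stepWeight, ENNReal.one_lt_top]
  refine Measure.ext_of_runCylinder fun n γ => ?_
  rw [happ _ (measurableSet_runCylinder n γ)]
  by_cases hs : (γ 0).state = s
  swap
  · rw [runLaw_runCylinder_of_ne _ _ _ _ hs]
    refine (ENNReal.tsum_eq_zero.2 fun i => ?_).symm
    rw [preimage_consRun_runCylinder_of_ne, measure_empty, mul_zero]
    rintro h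
    exact hs (h ▸ rfl)
  subst hs
  -- Only components whose first step is `γ 0` charge the cylinder. The next state is still free if
  -- `n = 0`, and is fixed by `γ 1` otherwise.
  rw [ENNReal.tsum_prod', tsum_eq_single (γ 0).act1]
  swap
  · intro a ha
    refine ENNReal.tsum_eq_zero.2 fun i => ?_
    rw [preimage_consRun_runCylinder_of_ne, measure_empty, mul_zero]
    exact fun h => ha (h ▸ rfl)
  rw [ENNReal.tsum_prod', tsum_eq_single (γ 0).act2]
  swap
  · intro a ha
    refine ENNReal.tsum_eq_zero.2 fun i => ?_
    rw [preimage_consRun_runCylinder_of_ne, measure_empty, mul_zero]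
    exact fun h => ha (h ▸ rfl)
  change _ = ∑' s', G.stepWeight π₁ π₂ (γ 0).state ((γ 0).act1, (γ 0).act2, s') *
    G.runLaw (π₁.after (γ 0)) (π₂.after (γ 0)) s' (consRun (γ 0) ⁻¹' runCylinder n γ)
  have hstep : G.stepAt π₁ π₂ [] (γ 0).state (γ 0) =
      π₁.act [] (γ 0).state (γ 0).act1 * π₂.act [] (γ 0).state (γ 0).act2 := by
    classical
    rw [stepAt_apply, if_pos rfl]
  cases n with
  | zero =>
    rw [preimage_consRun_runCylinder_zero, runLaw_runCylinder_zero]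
    simp only [measure_univ, mul_one, stepWeight, ENNReal.tsum_mul_left, PMF.tsum_coe, hstep]
  | succ n =>
    rw [preimage_consRun_runCylinder_succ, tsum_eq_single (γ 1).state,
      runLaw_runCylinder_succ', hstep]
    · rfl
    · intro s' hs'
      rw [runLaw_runCylinder_of_ne, mul_zero]
      exact hs'.symm

theorem lintegral_runLaw (π₁ : G.Policy1) (π₂ : G.Policy2) (s : S)
    {f : (ℕ → GameStep S A B) → ℝ≥0∞} (hf : Measurable f) :
    ∫⁻ γ, f γ ∂G.runLaw π₁ π₂ s = ∑' i : A × B × S, G.stepWeight π₁ π₂ s i *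
      ∫⁻ γ, f (consRun ⟨s, i.1, i.2.1⟩ γ) ∂G.tailLaw π₁ π₂ s i := by
  rw [runLaw_eq_sum, lintegral_sum_measure]
  refine tsum_congr fun i => ?_
  rw [lintegral_smul_measure, lintegral_map hf (measurable_consRun _), smul_eq_mul]

theorem runLaw_apply (π₁ : G.Policy1) (π₂ : G.Policy2) (s : S)
    {E : Set (ℕ → GameStep S A B)} (hE : MeasurableSet E) :
    G.runLaw π₁ π₂ s E = ∑' i : A × B × S, G.stepWeight π₁ π₂ s i *
      G.tailLaw π₁ π₂ s i (consRun ⟨s, i.1, i.2.1⟩ ⁻¹' E) := by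
  rw [runLaw_eq_sum, Measure.sum_apply _ hE]
  refine tsum_congr fun i => ?_
  rw [Measure.smul_apply, smul_eq_mul, Measure.map_apply (measurable_consRun _) hE]

lemma runLaw_eq_zero_iff (π₁ : G.Policy1) (π₂ : G.Policy2) (s : S)
    {E : Set (ℕ → GameStep S A B)} (hE : MeasurableSet E) :
    G.runLaw π₁ π₂ s E = 0 ↔ ∀ i : A × B × S, G.stepWeight π₁ π₂ s i ≠ 0 →
      G.tailLaw π₁ π₂ s i (consRun ⟨s, i.1, i.2.1⟩ ⁻¹' E) = 0 := by
  rw [runLaw_apply _ _ _ _ hE, ENNReal.tsum_eq_zero]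
  simp only [mul_eq_zero, ne_eq, or_iff_not_imp_left]

/-- A relation between continuation policies and states that is preserved by the play and forbids
the set `C` keeps the run away from `C`. -/
theorem reachProb_eq_zero_of_invariant {C : Set S} (R : G.Policy1 → G.Policy2 → S → Prop)
    (hC : ∀ π₁ π₂ s, R π₁ π₂ s → s ∉ C)
    (hR : ∀ π₁ π₂ s, R π₁ π₂ s → ∀ a ∈ (π₁.act [] s).support, ∀ b ∈ (π₂.act [] s).support,
      ∀ s' ∈ (G.P s a b).support, R (π₁.after ⟨s, a, b⟩) (π₂.after ⟨s, a, b⟩) s')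
    {π₁ : G.Policy1} {π₂ : G.Policy2} {s : S} (h : R π₁ π₂ s) :
    G.reachProb π₁ π₂ C s = 0 := by
  have key : ∀ (t : ℕ) (π₁ : G.Policy1) (π₂ : G.Policy2) (s : S), R π₁ π₂ s →
      G.runLaw π₁ π₂ s {γ | (γ t).state ∈ C} = 0 := by
    intro t
    induction t with
    | zero =>
      intro π₁ π₂ s h
      rw [runLaw_eq_zero_iff _ _ _ _ (measurableSet_state C 0)]
      intro i _
      convert measure_empty (μ := G.tailLaw π₁ π₂ s i)
      ext γ
      simpa using hC _ _ _ h
    | succ t ih =>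
      intro π₁ π₂ s h
      rw [runLaw_eq_zero_iff _ _ _ _ (measurableSet_state C (t + 1))]
      intro i hi
      obtain ⟨h1, h2, h3⟩ := G.stepWeight_ne_zero.1 hi
      exact ih _ _ _ (hR _ _ _ h _ h1 _ h2 _ h3)
  rw [reachProb, show {γ : ℕ → GameStep S A B | ∃ t, (γ t).state ∈ C} =
    ⋃ t, {γ | (γ t).state ∈ C} by ext; simp]
  exact measure_iUnion_null fun t => key t _ _ _ h

end ICGame

/-! ### Trap states, winning policies and the actions that preserve winning -/

namespace GamePolicy

variable {S A B C : Type*} {avail : S → Set C}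

/-- The policy that always chooses its action in the state `s` according to `d s`. -/
def stationary (d : S → PMF C) (hd : ∀ s, (d s).support ⊆ avail s) : GamePolicy S A B avail where
  act _ s := d s
  act_mem _ s := hd s

/-- The policy that chooses the first action according to `d` and then follows `π`. -/
def startWith (d : S → PMF C) (hd : ∀ s, (d s).support ⊆ avail s) (π : GamePolicy S A B avail) :
    GamePolicy S A B avail where
  act past s := match past with
    | [] => d s
    | _ :: past => π.act past s
  act_mem past s := match past with
    | [] => hd s
    | _ :: past => π.act_mem past s

@[simp] lemma stationary_act (d : S → PMF C) (hd : ∀ s, (d s).support ⊆ avail s)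
    (past : List (GameStep S A B)) (s : S) :
    (stationary d hd : GamePolicy S A B avail).act past s = d s := rfl

@[simp] lemma startWith_act_nil (d : S → PMF C) (hd : ∀ s, (d s).support ⊆ avail s)
    (π : GamePolicy S A B avail) (s : S) : (startWith d hd π).act [] s = d s := rfl

lemma support_pure_subset {f : S → C} (hf : ∀ s, f s ∈ avail s) (s : S) :
    (PMF.pure (f s)).support ⊆ avail s := by
  rw [PMF.support_pure, Set.singleton_subset_iff]
  exact hf s

end GamePolicy

namespace ICGame

variable {S A B : Type*} (G : ICGame S A B)

lemma exists_action2 {s : S} {b : B} (hb : b ∈ G.A2 s) :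
    ∃ f : S → B, (∀ s, f s ∈ G.A2 s) ∧ f s = b := by
  classical
  refine ⟨Function.update (fun s => (G.A2_nonempty s).some) s b, fun s' => ?_, by simp⟩
  by_cases h : s' = s
  · subst h
    simpa using hb
  · simpa [h] using (G.A2_nonempty s').some_mem

@[simp] lemma avPolicy_act (past : List (GameStep S A B)) (s : S) :
    G.avPolicy.act past s = G.av s := rfl

@[simp] lemma avPolicy_after (x : GameStep S A B) : G.avPolicy.after x = G.avPolicy := rfl

lemma measurableSet_reach (C : Set S) :
    MeasurableSet {γ : ℕ → GameStep S A B | ∃ t, (γ t).state ∈ C} := by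
  rw [show {γ : ℕ → GameStep S A B | ∃ t, (γ t).state ∈ C} =
    ⋃ t, {γ | (γ t).state ∈ C} by ext; simp]
  exact MeasurableSet.iUnion fun t => measurableSet_state C t

variable [Finite S] [Finite A] [Finite B]

lemma reachProb_eq_one_iff {π₁ : G.Policy1} {π₂ : G.Policy2} {C : Set S} {s : S} :
    G.reachProb π₁ π₂ C s = 1 ↔ G.runLaw π₁ π₂ s {γ | ∀ t, (γ t).state ∉ C} = 0 := by
  rw [reachProb, ← prob_compl_eq_zero_iff (measurableSet_reach C)]
  congr! 2
  ext γ
  simp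

lemma reachProb_of_mem (π₁ : G.Policy1) (π₂ : G.Policy2) {C : Set S} {s : S} (h : s ∈ C) :
    G.reachProb π₁ π₂ C s = 1 := by
  rw [reachProb_eq_one_iff]
  refine measure_mono_null (t := {γ | (γ 0).state ∈ Cᶜ}) (fun γ hγ => hγ 0) ?_
  rw [runLaw_eq_zero_iff _ _ _ _ (measurableSet_state _ 0)]
  intro i _
  convert measure_empty (μ := G.tailLaw π₁ π₂ s i)
  ext γ
  simpa using h

lemma not_mem_of_reachProb_eq_zero {π₁ : G.Policy1} {π₂ : G.Policy2} {C : Set S} {s : S}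
    (h : G.reachProb π₁ π₂ C s = 0) : s ∉ C := by
  intro hs
  rw [reachProb_of_mem _ _ _ hs] at h
  exact one_ne_zero h

/-- A null event has null continuations after every step of positive weight. The start must lie
outside `C`, for otherwise `C` is reached at time 0 and nothing follows about the rest. -/
lemma reachProb_after_eq_one {π₁ : G.Policy1} {π₂ : G.Policy2} {C : Set S} {s : S} (hs : s ∉ C)
    (h : G.reachProb π₁ π₂ C s = 1) {a : A} (ha : a ∈ (π₁.act [] s).support) {b : B}
    (hb : b ∈ (π₂.act [] s).support) {s' : S} (hs' : s' ∈ (G.P s a b).support) :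
    G.reachProb (π₁.after ⟨s, a, b⟩) (π₂.after ⟨s, a, b⟩) C s' = 1 := by
  rw [reachProb_eq_one_iff] at h ⊢
  have hm : MeasurableSet {γ : ℕ → GameStep S A B | ∀ t, (γ t).state ∉ C} := by
    rw [show {γ : ℕ → GameStep S A B | ∀ t, (γ t).state ∉ C} =
      {γ : ℕ → GameStep S A B | ∃ t, (γ t).state ∈ C}ᶜ by ext; simp]
    exact (measurableSet_reach C).compl
  rw [runLaw_eq_zero_iff _ _ _ _ hm] at h
  refine measure_mono_null ?_ (h (a, b, s') (G.stepWeight_ne_zero.2 ⟨ha, hb, hs'⟩))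
  intro γ hγ t
  cases t with
  | zero => exact hs
  | succ t => exact hγ t

lemma reachProb_after_eq_zero {π₁ : G.Policy1} {π₂ : G.Policy2} {C : Set S} {s : S}
    (h : G.reachProb π₁ π₂ C s = 0) {a : A} (ha : a ∈ (π₁.act [] s).support) {b : B}
    (hb : b ∈ (π₂.act [] s).support) {s' : S} (hs' : s' ∈ (G.P s a b).support) :
    G.reachProb (π₁.after ⟨s, a, b⟩) (π₂.after ⟨s, a, b⟩) C s' = 0 := by
  rw [reachProb, runLaw_eq_zero_iff _ _ _ _ (measurableSet_reach C)] at h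
  refine measure_mono_null ?_ (h (a, b, s') (G.stepWeight_ne_zero.2 ⟨ha, hb, hs'⟩))
  rintro γ ⟨t, ht⟩
  exact ⟨t + 1, ht⟩

/-- The policy `π₁` wins almost surely and avoids the trap states from `s`. -/
def IsWinning (π₁ : G.Policy1) (s : S) : Prop :=
  ∀ π₂ : G.Policy2, G.reachProb π₁ π₂ G.SR s = 1 ∧ G.reachProb π₁ π₂ G.trap s = 0

variable {G}

/-- Any adversary of the continuation becomes an adversary of `π₁` by playing `b` first. -/
lemma IsWinning.after {π₁ : G.Policy1} {s : S} (h : G.IsWinning π₁ s) (hs : s ∉ G.SR) {a : A}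
    (ha : a ∈ (π₁.act [] s).support) {b : B} (hb : b ∈ G.A2 s) {s' : S}
    (hs' : s' ∈ (G.P s a b).support) : G.IsWinning (π₁.after ⟨s, a, b⟩) s' := by
  intro π₂
  obtain ⟨f, hf, rfl⟩ := G.exists_action2 hb
  have hb' : f s ∈ ((GamePolicy.startWith (fun s => PMF.pure (f s))
      (GamePolicy.support_pure_subset hf) π₂).act [] s).support := by simp
  exact ⟨G.reachProb_after_eq_one hs (h _).1 ha hb' hs',
    G.reachProb_after_eq_zero (h _).2 ha hb' hs'⟩

lemma not_mem_trap_of_mem_potentiallyWinning {s : S} (h : s ∈ G.potentiallyWinning) :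
    s ∉ G.trap := by
  obtain ⟨π₁, h⟩ := h
  obtain ⟨f, hf⟩ : ∃ f : S → B, ∀ s, f s ∈ G.A2 s :=
    ⟨fun s => (G.A2_nonempty s).some, fun s => (G.A2_nonempty s).some_mem⟩
  exact G.not_mem_of_reachProb_eq_zero
    (h (GamePolicy.stationary _ (GamePolicy.support_pure_subset hf))).2

lemma not_mem_SR_of_mem_trap {s : S} (h : s ∈ G.trap) : s ∉ G.SR := by
  obtain ⟨π₂, h⟩ := h
  exact G.not_mem_of_reachProb_eq_zero h

lemma exists_action_of_mem_trap {s : S} (h : s ∈ G.trap) :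
    ∃ b ∈ G.A2 s, ∀ a ∈ (G.av s).support, ∀ s' ∈ (G.P s a b).support, s' ∈ G.trap := by
  obtain ⟨π₂, h⟩ := h
  obtain ⟨b, hb⟩ := (π₂.act [] s).support_nonempty
  exact ⟨b, π₂.act_mem _ _ hb, fun a ha s' hs' => ⟨_, G.reachProb_after_eq_zero h ha hb hs'⟩⟩

/-- Playing the closing action in each state of `Z` is a stationary policy of Player 2 that holds
the average player in `Z` forever. With `exists_action_of_mem_trap`, this makes the trap the largest
such set. -/
lemma subset_trap_of_closed {Z : Set S} (hZ : ∀ s ∈ Z, s ∉ G.SR)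
    (hb : ∀ s ∈ Z, ∃ b ∈ G.A2 s, ∀ a ∈ (G.av s).support, ∀ s' ∈ (G.P s a b).support, s' ∈ Z) :
    Z ⊆ G.trap := by
  have : ∀ s, ∃ b ∈ G.A2 s, s ∈ Z →
      ∀ a ∈ (G.av s).support, ∀ s' ∈ (G.P s a b).support, s' ∈ Z := by
    intro s
    by_cases hs : s ∈ Z
    · obtain ⟨b, h1, h2⟩ := hb s hs
      exact ⟨b, h1, fun _ => h2⟩
    · exact ⟨_, (G.A2_nonempty s).some_mem, fun h => absurd h hs⟩
  choose f hf hfZ using this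
  intro s hs
  refine ⟨GamePolicy.stationary _ (GamePolicy.support_pure_subset hf),
    G.reachProb_eq_zero_of_invariant (fun π₁ π₂ s => π₁ = G.avPolicy ∧ π₂ =
      GamePolicy.stationary _ (GamePolicy.support_pure_subset hf) ∧ s ∈ Z) ?_ ?_ ⟨rfl, rfl, hs⟩⟩
  · exact fun _ _ s h => hZ s h.2.2
  · rintro _ _ s ⟨rfl, rfl, h⟩ a ha b hb s' hs'
    obtain rfl : b = f s := by simpa using hb
    exact ⟨rfl, rfl, hfZ s h a ha s' hs'⟩

variable (G) in
/-- The actions of Player 1 after which the next state is potentially winning, whatever Player 2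
does. -/
def stayActions (s : S) : Set A :=
  {a ∈ G.A1 s | ∀ b ∈ G.A2 s, ∀ s' ∈ (G.P s a b).support, s' ∈ G.potentiallyWinning}

lemma IsWinning.mem_stayActions {π₁ : G.Policy1} {s : S} (h : G.IsWinning π₁ s) (hs : s ∉ G.SR)
    {a : A} (ha : a ∈ (π₁.act [] s).support) : a ∈ G.stayActions s :=
  ⟨π₁.act_mem _ _ ha, fun _ hb _ hs' => ⟨_, h.after hs ha hb hs'⟩⟩

lemma stayActions_nonempty {s : S} (h : s ∈ G.potentiallyWinning) (hs : s ∉ G.SR) :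
    (G.stayActions s).Nonempty := by
  obtain ⟨π₁, h⟩ := h
  obtain ⟨a, ha⟩ := (π₁.act [] s).support_nonempty
  exact ⟨a, IsWinning.mem_stayActions h hs ha⟩

/-- Player 2 cannot confine the play to a set of potentially winning states without winning states
as long as Player 1 may take all the actions that keep the play potentially winning. -/
lemma exists_stayActions_escape {Z : Set S} (hne : Z.Nonempty)
    (hZ : Z ⊆ G.potentiallyWinning \ G.SR) :
    ∃ s ∈ Z, ∀ b ∈ G.A2 s, ∃ a ∈ G.stayActions s, ∃ s' ∈ (G.P s a b).support, s' ∉ Z := by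
  by_contra! hb
  have : ∀ s, ∃ b ∈ G.A2 s, s ∈ Z →
      ∀ a ∈ G.stayActions s, ∀ s' ∈ (G.P s a b).support, s' ∈ Z := by
    intro s
    by_cases hs : s ∈ Z
    · obtain ⟨b, h1, h2⟩ := hb s hs
      exact ⟨b, h1, fun _ => h2⟩
    · exact ⟨_, (G.A2_nonempty s).some_mem, fun h => absurd h hs⟩
  choose f hf hfZ using this
  obtain ⟨s, hs⟩ := hne
  obtain ⟨π₁, hπ₁⟩ := (hZ hs).1
  have h0 : G.reachProb π₁ (GamePolicy.stationary _ (GamePolicy.support_pure_subset hf))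
      G.SR s = 0 := by
    -- A winning policy plays only stay actions and remains winning, so the confining choice `f`
    -- would hold it in `Z`, although it must win with probability one.
    refine G.reachProb_eq_zero_of_invariant (fun π₁ π₂ s => G.IsWinning π₁ s ∧ π₂ =
      GamePolicy.stationary _ (GamePolicy.support_pure_subset hf) ∧ s ∈ Z) ?_ ?_ ⟨hπ₁, rfl, hs⟩
    · exact fun _ _ s h => (hZ h.2.2).2
    · rintro π₁ _ s ⟨h1, rfl, h⟩ a ha b hb s' hs'
      obtain rfl : b = f s := by simpa using hb
      exact ⟨h1.after (hZ h).2 ha (hf s) hs', rfl,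
        hfZ s h a (h1.mem_stayActions (hZ h).2 ha) s' hs'⟩
  rw [(hπ₁ _).1] at h0
  exact one_ne_zero h0

end ICGame

/-! ### Ranks and drift functions -/

/-- The positive values of a function on a finite type are bounded away from zero. -/
lemma exists_pos_le_of_pos {ι : Type*} [Finite ι] (f : ι → ℝ) :
    ∃ p : ℝ, 0 < p ∧ p ≤ 1 ∧ ∀ i, 0 < f i → p ≤ f i := by
  have hfin : (insert 1 {x : ℝ | ∃ i, 0 < f i ∧ f i = x}).Finite :=
    (Set.Finite.subset (Set.finite_range f) (by rintro x ⟨i, _, rfl⟩; exact ⟨i, rfl⟩)).insert 1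
  obtain ⟨p, hp, hmin⟩ := Set.exists_min_image _ id hfin ⟨1, Set.mem_insert _ _⟩
  refine ⟨p, ?_, hmin 1 (Set.mem_insert _ _), fun i hi =>
    hmin _ (Set.mem_insert_of_mem _ ⟨i, hi, rfl⟩)⟩
  rcases hp with rfl | ⟨i, hi, rfl⟩
  exacts [one_pos, hi]

/-- If no nonempty subset of `D` can be closed off from `T` and from the rest of `D`, then there is
a rank function on `T ∪ D` that decreases with positive probability at each step from `D`. -/
lemma exists_rank {S B : Type*} [Finite B] (avail : S → Set B) (q : S → B → PMF S)
    {T D : Set S} (hTD : Disjoint T D)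
    (hq : ∀ Z ⊆ D, Z.Nonempty → ∃ s ∈ Z, ∀ b ∈ avail s, ∃ s' ∈ (q s b).support,
      s' ∈ T ∨ s' ∈ D \ Z) :
    ∃ r : S → ℕ, ∀ s ∈ D, ∀ b ∈ avail s, ∃ s' ∈ (q s b).support, s' ∈ T ∪ D ∧ r s' < r s := by
  classical
  have := Fintype.ofFinite B
  -- Attractor iteration: `W k` collects the states from which each action of Player 2 leaves a
  -- chance to progress towards `T` in `k` rounds. The states of `D` never collected would violate
  -- `hq`.
  let F : Set S → Set S := fun W =>
    W ∪ {s | s ∈ D ∧ ∀ b ∈ avail s, ∃ s' ∈ (q s b).support, s' ∈ W}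
  let W : ℕ → Set S := fun k => F^[k] T
  have hW0 : W 0 = T := rfl
  have hWs : ∀ k, W (k + 1) = F (W k) := fun k => Function.iterate_succ_apply' F k T
  have hmono : Monotone W := monotone_nat_of_le_succ fun k => by
    rw [hWs]; exact Set.subset_union_left
  have hsub : ∀ k, W k ⊆ T ∪ D := by
    intro k
    induction k with
    | zero => exact Set.subset_union_left
    | succ k ih =>
      rw [hWs]
      exact Set.union_subset ih fun s hs => Or.inr hs.1
  have hex : ∀ s ∈ D, ∃ k, s ∈ W k := by
    by_contra! hcon
    obtain ⟨s₁, hs₁, hk₁⟩ := hcon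
    obtain ⟨s, hs, hb⟩ := hq {s | s ∈ D ∧ ∀ k, s ∉ W k} (fun s hs => hs.1) ⟨s₁, hs₁, hk₁⟩
    have hb' : ∀ b, ∃ k, b ∈ avail s → ∃ s' ∈ (q s b).support, s' ∈ W k := by
      intro b
      by_cases hbs : b ∈ avail s
      · obtain ⟨s', h1, h2⟩ := hb b hbs
        obtain ⟨k, hk⟩ : ∃ k, s' ∈ W k := by
          rcases h2 with h2 | ⟨h2, h3⟩
          · exact ⟨0, h2⟩
          · by_contra! h4
            exact h3 ⟨h2, h4⟩
        exact ⟨k, fun _ => ⟨s', h1, hk⟩⟩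
      · exact ⟨0, fun h => absurd h hbs⟩
    choose k hk using hb'
    -- Finitely many actions of Player 2 allow one index for all of them.
    refine hs.2 (Finset.univ.sup k + 1) ?_
    rw [hWs]
    refine Or.inr ⟨hs.1, fun b hbs => ?_⟩
    obtain ⟨s', h1, h2⟩ := hk b hbs
    exact ⟨s', h1, hmono (Finset.le_sup (Finset.mem_univ b)) h2⟩
  refine ⟨fun s => sInf {k | s ∈ W k}, fun s hs b hb => ?_⟩
  have hmem : s ∈ W (sInf {k | s ∈ W k}) := Nat.sInf_mem (hex s hs)
  obtain ⟨k, hk⟩ : ∃ k, sInf {k | s ∈ W k} = k + 1 := by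
    refine Nat.exists_eq_succ_of_ne_zero fun h0 => ?_
    rw [h0] at hmem
    exact Set.disjoint_left.1 hTD hmem hs
  rw [hk, hWs] at hmem
  rcases hmem with hmem | hmem
  · have : sInf {k | s ∈ W k} ≤ k := Nat.sInf_le hmem
    omega
  · obtain ⟨s', h1, h2⟩ := hmem.2 b hb
    refine ⟨s', h1, hsub k h2, ?_⟩
    have : sInf {k | s' ∈ W k} ≤ k := Nat.sInf_le h2
    simp only [hk]
    omega

/-- If no nonempty subset of `D` can be closed off from `T` and from the rest of `D`, then there is
a function that decreases in expectation by a constant factor at each step from `D`. -/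
lemma exists_drift {S B : Type*} [Finite S] [Finite B] (avail : S → Set B) (q : S → B → PMF S)
    {T D : Set S} (hTD : Disjoint T D)
    (hq : ∀ Z ⊆ D, Z.Nonempty → ∃ s ∈ Z, ∀ b ∈ avail s, ∃ s' ∈ (q s b).support,
      s' ∈ T ∨ s' ∈ D \ Z) :
    ∃ θ : ℝ, 1 < θ ∧ ∃ h : S → ℝ≥0∞, (∀ s, 1 ≤ h s) ∧ (∀ s, h s ≤ 2) ∧
      (∀ s, s ∉ T → s ∉ D → h s = 2) ∧
      ∀ s ∈ D, ∀ b ∈ avail s, ENNReal.ofReal θ * ∑' s', q s b s' * h s' ≤ h s := by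
  classical
  have := Fintype.ofFinite S
  obtain ⟨r, hr⟩ := exists_rank avail q hTD hq
  obtain ⟨p, hp0, hp1, hp⟩ := exists_pos_le_of_pos
    fun i : S × B × S => (q i.1 i.2.1 i.2.2).toReal
  -- With `c = p / 2`, a rank drop of probability at least `p` makes the expected gap `2 - g` at
  -- least `2 * c ^ r s`, twice the present gap. The margin pays for a factor `1 + c ^ r s / 2`, and
  -- `c ^ m` makes it uniform in `s`.
  set c : ℝ := p / 2 with hc
  have hc0 : 0 < c := by positivity
  have hc1 : c ≤ 1 := by linarith
  set m : ℕ := Finset.univ.sup r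
  set g : S → ℝ := fun s => if s ∈ T ∪ D then 2 - c ^ r s else 2 with hg
  have hpow : ∀ n : ℕ, 0 < c ^ n ∧ c ^ n ≤ 1 := fun n =>
    ⟨pow_pos hc0 n, pow_le_one₀ hc0.le hc1⟩
  have hg1 : ∀ s, 1 ≤ g s := by
    intro s
    have := (hpow (r s)).2
    simp only [hg]
    split_ifs <;> linarith
  have hg2 : ∀ s, g s ≤ 2 := by
    intro s
    have := (hpow (r s)).1
    simp only [hg]
    split_ifs <;> linarith
  refine ⟨1 + c ^ m / 2, by linarith [(hpow m).1], fun s => ENNReal.ofReal (g s), ?_, ?_, ?_, ?_⟩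
  · intro s
    rw [ENNReal.one_le_ofReal]
    exact hg1 s
  · intro s
    exact (ENNReal.ofReal_le_ofReal (hg2 s)).trans (by simp)
  · intro s h1 h2
    simp [hg, h1, h2]
  · intro s hs b hb
    have hfin : ∀ s', q s b s' ≠ ∞ := fun s' => PMF.apply_ne_top _ _
    have hsum : ∑' s', q s b s' * ENNReal.ofReal (g s') =
        ENNReal.ofReal (∑ s', (q s b s').toReal * g s') := by
      rw [tsum_fintype, ENNReal.ofReal_sum_of_nonneg]
      · refine Finset.sum_congr rfl fun s' _ => ?_
        rw [ENNReal.ofReal_mul ENNReal.toReal_nonneg, ENNReal.ofReal_toReal (hfin s')]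
      · intro s' _
        exact mul_nonneg ENNReal.toReal_nonneg (by linarith [hg1 s'])
    have hone : ∑ s', (q s b s').toReal = 1 := by
      rw [← ENNReal.toReal_sum fun s' _ => hfin s', ← tsum_fintype (L := .unconditional _),
        PMF.tsum_coe, ENNReal.toReal_one]
    obtain ⟨s₁, h1, h2, h3⟩ := hr s hs b hb
    have hq1 : p ≤ (q s b s₁).toReal :=
      hp (s, b, s₁) (ENNReal.toReal_pos ((PMF.mem_support_iff _ _).1 h1) (hfin _))
    have hle : ∑ s', (q s b s').toReal * g s' ≤ 2 - 2 * c ^ r s := by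
      calc ∑ s', (q s b s').toReal * g s'
          ≤ ∑ s', ((q s b s').toReal * 2 - if s' = s₁ then p * c ^ r s₁ else 0) := by
            refine Finset.sum_le_sum fun s' _ => ?_
            split_ifs with h
            · subst h
              have : g s' = 2 - c ^ r s' := if_pos h2
              rw [this]
              have := mul_le_mul_of_nonneg_right hq1 (hpow (r s')).1.le
              linarith
            · have := mul_le_mul_of_nonneg_left (hg2 s')
                (ENNReal.toReal_nonneg (a := q s b s'))
              linarith
        _ = 2 - p * c ^ r s₁ := by
            rw [Finset.sum_sub_distrib, ← Finset.sum_mul, hone, Finset.sum_ite_eq' Finset.univ s₁]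
            simp
        _ ≤ 2 - 2 * c ^ r s := by
            have h4 : c ^ r s ≤ c ^ (r s₁ + 1) := pow_le_pow_of_le_one hc0.le hc1 h3
            have h5 : p * c ^ r s₁ = 2 * c ^ (r s₁ + 1) := by rw [pow_succ, hc]; ring
            linarith
    have hgs : g s = 2 - c ^ r s := if_pos (Or.inr hs)
    have hm : c ^ m ≤ c ^ r s :=
      pow_le_pow_of_le_one hc0.le hc1 (Finset.le_sup (Finset.mem_univ s))
    rw [hsum, ← ENNReal.ofReal_mul (by linarith [(hpow m).1])]
    refine ENNReal.ofReal_le_ofReal ?_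
    rw [hgs]
    calc (1 + c ^ m / 2) * ∑ s', (q s b s').toReal * g s'
        ≤ (1 + c ^ r s / 2) * (2 - 2 * c ^ r s) := by
          refine mul_le_mul (by linarith) hle (Finset.sum_nonneg fun s' _ =>
            mul_nonneg ENNReal.toReal_nonneg (by linarith [hg1 s'])) ?_
          linarith [(hpow (r s)).1]
      _ ≤ 2 - c ^ r s := by nlinarith [(hpow (r s)).1]

/-! ### Exponential moments of the number of visits -/

open Classical in
/-- The number of visits to `D` before time `T`. -/
noncomputable def visits {S A B : Type*} (D : Set S) (T : ℕ) (γ : ℕ → GameStep S A B) : ℕ :=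
  ∑ t ∈ Finset.range T, if (γ t).state ∈ D then 1 else 0

open Classical in
lemma visits_consRun {S A B : Type*} (D : Set S) (T : ℕ) (x : GameStep S A B)
    (γ : ℕ → GameStep S A B) :
    visits D (T + 1) (consRun x γ) = visits D T γ + if x.state ∈ D then 1 else 0 :=
  Finset.sum_range_succ' _ _

lemma measurable_visits {S A B : Type*} (D : Set S) (T : ℕ) :
    Measurable (visits D T : (ℕ → GameStep S A B) → ℕ) := by
  classical
  refine Finset.measurable_fun_sum _ fun t _ => ?_
  exact (Measurable.of_discrete (f := fun x : GameStep S A B => if x.state ∈ D then 1 else 0)).comp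
    (measurable_pi_apply t)

lemma lintegral_visits {S A B : Type*} (μ : Measure (ℕ → GameStep S A B)) (D : Set S) (T : ℕ) :
    ∫⁻ γ, (visits D T γ : ℝ≥0∞) ∂μ = ∑ t ∈ Finset.range T, μ {γ | (γ t).state ∈ D} := by
  classical
  have h (γ : ℕ → GameStep S A B) : (visits D T γ : ℝ≥0∞) =
      ∑ t ∈ Finset.range T, Set.indicator {γ | (γ t).state ∈ D} 1 γ := by
    simp [visits, Set.indicator_apply]
  simp_rw [h]
  rw [lintegral_finsetSum _ fun t _ => measurable_one.indicator (ICGame.measurableSet_state D t)]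
  simp_rw [lintegral_indicator_one (ICGame.measurableSet_state D _)]

namespace ICGame

variable {S A B : Type*} (G : ICGame S A B) [Finite S] [Finite A] [Finite B]

open Classical in
/-- If, along the play, `h` decreases in expectation by the factor `θ` at each step from `D`, then
the number of visits to `D` has an exponential moment. -/
theorem lintegral_pow_visits_le (θ : ℝ≥0∞) (D : Set S) (h : S → ℝ≥0∞) (h1 : ∀ s, 1 ≤ h s)
    (R : G.Policy1 → S → Prop)
    (hR : ∀ π₁ s, R π₁ s → ∀ b ∈ G.A2 s, (if s ∈ D then θ else 1) *
      ∑' a, π₁.act [] s a * ∑' s', G.P s a b s' * h s' ≤ h s)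
    (hR' : ∀ π₁ s, R π₁ s → ∀ a ∈ (π₁.act [] s).support, ∀ b ∈ G.A2 s,
      ∀ s' ∈ (G.P s a b).support, R (π₁.after ⟨s, a, b⟩) s')
    (T : ℕ) {π₁ : G.Policy1} (π₂ : G.Policy2) {s : S} (hs : R π₁ s) :
    ∫⁻ γ, θ ^ visits D T γ ∂G.runLaw π₁ π₂ s ≤ h s := by
  have hmeas : ∀ T, Measurable fun γ : ℕ → GameStep S A B => θ ^ visits D T γ := fun T =>
    (Measurable.of_discrete (f := fun n : ℕ => θ ^ n)).comp (measurable_visits D T)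
  induction T generalizing π₁ π₂ s with
  | zero => simpa [visits] using h1 s
  | succ T ih =>
    set d : ℝ≥0∞ := if s ∈ D then θ else 1 with hd
    rw [lintegral_runLaw _ _ _ _ (hmeas (T + 1))]
    have hcons : ∀ (i : A × B × S) (γ : ℕ → GameStep S A B),
        θ ^ visits D (T + 1) (consRun ⟨s, i.1, i.2.1⟩ γ) = θ ^ visits D T γ * d := by
      intro i γ
      rw [visits_consRun, pow_add, hd]
      split_ifs <;> simp
    simp_rw [hcons, lintegral_mul_const _ (hmeas T)]
    calc ∑' i, G.stepWeight π₁ π₂ s i * ((∫⁻ γ, θ ^ visits D T γ ∂G.tailLaw π₁ π₂ s i) * d)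
        ≤ ∑' i : A × B × S, G.stepWeight π₁ π₂ s i * (h i.2.2 * d) := by
          refine ENNReal.tsum_le_tsum fun i => ?_
          by_cases hi : G.stepWeight π₁ π₂ s i = 0
          · simp [hi]
          obtain ⟨ha, hb, hs'⟩ := G.stepWeight_ne_zero.1 hi
          gcongr
          exact ih _ (hR' _ _ hs _ ha _ (π₂.act_mem _ _ hb) _ hs')
      -- The choices are independent, so Player 2's action can be summed last and the drift bound
      -- used for each fixed `b`.
      _ = ∑' b, π₂.act [] s b *
            (d * ∑' a, π₁.act [] s a * ∑' s', G.P s a b s' * h s') := by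
          simp_rw [ENNReal.tsum_prod', ← ENNReal.tsum_mul_left]
          rw [ENNReal.tsum_comm]
          refine tsum_congr fun b => tsum_congr fun a => tsum_congr fun s' => ?_
          rw [stepWeight]
          ring
      _ ≤ ∑' b, π₂.act [] s b * h s := by
          refine ENNReal.tsum_le_tsum fun b => ?_
          by_cases hb : π₂.act [] s b = 0
          · simp [hb]
          gcongr
          exact hR _ _ hs b (π₂.act_mem _ _ ((PMF.mem_support_iff _ _).2 hb))
      _ = h s := by rw [ENNReal.tsum_mul_right, PMF.tsum_coe, one_mul]

end ICGame

/-! ### Lower bound for the divergence, and part (2) -/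

/-- Fenchel's inequality: the convex conjugate of `klFun` at `log z` is `z - 1`. -/
lemma mul_log_le_klFun_add {x z : ℝ} (hx : 0 ≤ x) (hz : 0 < z) :
    x * Real.log z ≤ InformationTheory.klFun x + z := by
  rw [InformationTheory.klFun]
  rcases hx.eq_or_lt with rfl | hx
  · simp; linarith
  · have h := Real.add_one_le_exp (Real.log z - Real.log x)
    rw [Real.exp_sub, Real.exp_log hz, Real.exp_log hx] at h
    have h2 := mul_le_mul_of_nonneg_left h hx.le
    rw [mul_div_cancel₀ _ hx.ne'] at h2
    linarith

/-- A variational bound: the mean of a natural-valued function is controlled by the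
Kullback–Leibler divergence and by an exponential moment under the second measure. -/
lemma ofReal_log_mul_lintegral_le_klDiv_add {Ω : Type*} [MeasurableSpace Ω] (μ ν : Measure Ω)
    [IsProbabilityMeasure μ] [IsProbabilityMeasure ν] {f : Ω → ℕ} (hf : Measurable f) {θ : ℝ}
    (hθ : 1 < θ) :
    ENNReal.ofReal (Real.log θ) * ∫⁻ ω, f ω ∂μ ≤
      InformationTheory.klDiv μ ν + ∫⁻ ω, ENNReal.ofReal θ ^ f ω ∂ν := by
  by_cases hac : μ ≪ ν
  swap
  · simp [InformationTheory.klDiv_of_not_ac hac]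
  have hf' : Measurable fun ω => (f ω : ℝ≥0∞) := Measurable.of_discrete.comp hf
  have hpow : Measurable fun ω => ENNReal.ofReal θ ^ f ω :=
    (Measurable.of_discrete (f := fun n : ℕ => ENNReal.ofReal θ ^ n)).comp hf
  have hlog : 0 ≤ Real.log θ := Real.log_nonneg hθ.le
  rw [InformationTheory.klDiv_eq_lintegral_klFun_of_ac hac, ← lintegral_const_mul _ hf',
    ← lintegral_rnDeriv_mul hac (hf'.const_mul _).aemeasurable,
    ← lintegral_add_right _ hpow]
  refine lintegral_mono_ae ?_
  filter_upwards [μ.rnDeriv_lt_top ν] with ω hω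
  have hz : 0 < θ ^ f ω := pow_pos (by linarith) _
  calc μ.rnDeriv ν ω * (ENNReal.ofReal (Real.log θ) * f ω)
      = ENNReal.ofReal ((μ.rnDeriv ν ω).toReal * Real.log (θ ^ f ω)) := by
        rw [ENNReal.ofReal_mul ENNReal.toReal_nonneg, ENNReal.ofReal_toReal hω.ne, Real.log_pow,
          mul_comm (f ω : ℝ), ENNReal.ofReal_mul hlog, ENNReal.ofReal_natCast]
    _ ≤ ENNReal.ofReal (InformationTheory.klFun (μ.rnDeriv ν ω).toReal + θ ^ f ω) :=
        ENNReal.ofReal_le_ofReal (mul_log_le_klFun_add ENNReal.toReal_nonneg hz)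
    _ = _ := by
        rw [ENNReal.ofReal_add (InformationTheory.klFun_nonneg ENNReal.toReal_nonneg) hz.le,
          ENNReal.ofReal_pow (by linarith)]

/-- The variational bound for `visits D T` is uniform in the horizon `T`, which then tends to
infinity. The case `μ = ν` turns an exponential moment into a finite mean. -/
lemma tsum_measure_state_lt_top {S A B : Type*} (μ ν : Measure (ℕ → GameStep S A B))
    [IsProbabilityMeasure μ] [IsProbabilityMeasure ν] (D : Set S) {θ : ℝ} (hθ : 1 < θ) {M : ℝ≥0∞}
    (hM : M ≠ ∞) (hν : ∀ T, ∫⁻ γ, ENNReal.ofReal θ ^ visits D T γ ∂ν ≤ M)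
    (hkl : InformationTheory.klDiv μ ν ≠ ∞) : ∑' t, μ {γ | (γ t).state ∈ D} < ∞ := by
  have hlog : ENNReal.ofReal (Real.log θ) ≠ 0 := by
    simpa using Real.log_pos hθ
  have hbound : ∑' t, μ {γ | (γ t).state ∈ D} ≤
      (InformationTheory.klDiv μ ν + M) / ENNReal.ofReal (Real.log θ) := by
    rw [ENNReal.tsum_eq_iSup_nat]
    refine iSup_le fun T => ?_
    rw [ENNReal.le_div_iff_mul_le (Or.inl hlog) (Or.inl ENNReal.ofReal_ne_top), mul_comm,
      ← lintegral_visits]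
    exact (ofReal_log_mul_lintegral_le_klDiv_add μ ν (measurable_visits D T) hθ).trans
      (add_le_add_right (hν T) _)
  exact hbound.trans_lt (ENNReal.div_lt_top (ENNReal.add_ne_top.2 ⟨hkl, hM⟩) hlog)

namespace ICGame

variable {S A B : Type*} (G : ICGame S A B)

lemma tsum_step_of_mem_SR {π₁ : G.Policy1} {s : S} (hs : s ∈ G.SR) {b : B} (hb : b ∈ G.A2 s)
    (h : S → ℝ≥0∞) :
    ∑' a, π₁.act [] s a * ∑' s', G.P s a b s' * h s' = h s := by
  classical
  have : ∀ a, π₁.act [] s a * ∑' s', G.P s a b s' * h s' = π₁.act [] s a * h s := by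
    intro a
    by_cases ha : π₁.act [] s a = 0
    · simp [ha]
    rw [G.absorbing s hs a (π₁.act_mem _ _ ((PMF.mem_support_iff _ _).2 ha)) b hb]
    simp [PMF.pure_apply]
  simp_rw [this]
  rw [ENNReal.tsum_mul_right, PMF.tsum_coe, one_mul]

lemma tsum_bind_mul {α β : Type*} (p : PMF α) (q : α → PMF β) (h : β → ℝ≥0∞) :
    ∑' y, p.bind q y * h y = ∑' x, p x * ∑' y, q x y * h y := by
  simp_rw [PMF.bind_apply, ← ENNReal.tsum_mul_right, ← ENNReal.tsum_mul_left]
  rw [ENNReal.tsum_comm]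
  simp_rw [mul_assoc]

lemma tsum_mul_le_of_le {α : Type*} (p : PMF α) {h : α → ℝ≥0∞} {M : ℝ≥0∞} (hM : ∀ x, h x ≤ M) :
    ∑' x, p x * h x ≤ M := by
  calc ∑' x, p x * h x ≤ ∑' x, p x * M := ENNReal.tsum_le_tsum fun x => by gcongr; exact hM x
    _ = M := by rw [ENNReal.tsum_mul_right, PMF.tsum_coe, one_mul]

variable [Finite S] [Finite A] [Finite B]

/-- The number of visits of the average player to states that are neither winning nor trap states
has an exponential moment. -/
lemma exists_lintegral_pow_visits_avPolicy_le :
    ∃ θ : ℝ, 1 < θ ∧ ∀ (π₂ : G.Policy2) (s : S) (T : ℕ),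
      ∫⁻ γ, ENNReal.ofReal θ ^ visits (G.SR ∪ G.trap)ᶜ T γ ∂G.runLaw G.avPolicy π₂ s ≤ 2 := by
  classical
  obtain ⟨θ, hθ, h, h1, h2, htop, hdrift⟩ := exists_drift G.A2
    (fun s b => (G.av s).bind fun a => G.P s a b) (T := G.SR) (D := (G.SR ∪ G.trap)ᶜ)
    (Set.disjoint_left.2 fun s hs hs' => hs' (Or.inl hs)) (by
      intro Z hZ hne
      by_contra! hcon
      -- If Player 2 could prevent escape from `Z` to anything but the trap, then `Z ∪ G.trap` would
      -- be closed and `Z` would consist of trap states.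
      have hsub : Z ∪ G.trap ⊆ G.trap := by
        refine subset_trap_of_closed ?_ ?_
        · rintro s (hs | hs)
          · exact fun h => hZ hs (Or.inl h)
          · exact not_mem_SR_of_mem_trap hs
        · rintro s (hs | hs)
          · obtain ⟨b, hb, hbs⟩ := hcon s hs
            refine ⟨b, hb, fun a ha s' hs' => ?_⟩
            obtain ⟨h3, h4⟩ := hbs s' ((PMF.mem_support_bind_iff _ _ _).2 ⟨a, ha, hs'⟩)
            by_contra h5
            rw [Set.mem_union, not_or] at h5
            refine h4 ⟨fun h6 => ?_, h5.1⟩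
            rcases h6 with h6 | h6
            exacts [h3 h6, h5.2 h6]
          · obtain ⟨b, hb, hbs⟩ := exists_action_of_mem_trap hs
            exact ⟨b, hb, fun a ha s' hs' => Or.inr (hbs a ha s' hs')⟩
      obtain ⟨s, hs⟩ := hne
      exact hZ hs (Or.inr (hsub (Or.inl hs))))
  refine ⟨θ, hθ, fun π₂ s T => (G.lintegral_pow_visits_le (ENNReal.ofReal θ) _ h h1
    (fun π₁ _ => π₁ = G.avPolicy) ?_ ?_ T π₂ rfl).trans (h2 s)⟩
  · rintro _ s rfl b hb
    by_cases hs : s ∈ (G.SR ∪ G.trap)ᶜ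
    · rw [if_pos hs]
      refine le_trans (le_of_eq ?_) (hdrift s hs b hb)
      rw [tsum_bind_mul]
      rfl
    rw [if_neg hs, one_mul]
    by_cases hSR : s ∈ G.SR
    · rw [tsum_step_of_mem_SR _ hSR hb]
    -- On the trap `h` takes its maximal value 2, so no drift condition is needed there.
    · rw [htop s hSR hs]
      exact tsum_mul_le_of_le _ fun a => tsum_mul_le_of_le _ h2
  · rintro _ s rfl a _ b _ s' _
    rfl

lemma expectedTime_le (π₁ : G.Policy1) (π₂ : G.Policy2) {D : Set S} {s : S} (hs : s ∈ D) :
    G.expectedTime π₁ π₂ s ≤ ∑' t, G.runLaw π₁ π₂ G.s₀ {γ | (γ t).state ∈ D} := by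
  refine ENNReal.tsum_le_tsum fun t => measure_mono ?_
  rintro γ rfl
  exact hs

theorem klObjective_eq_top_of_expectedTime_eq_top {π₁ : G.Policy1} {π₂ : G.Policy2} {s : S}
    (hs : s ∈ G.potentiallyWinning \ G.SR) (h : G.expectedTime π₁ π₂ s = ∞) :
    G.klObjective π₁ π₂ = ∞ := by
  by_contra hkl
  obtain ⟨θ, hθ, hν⟩ := G.exists_lintegral_pow_visits_avPolicy_le
  have hsD : s ∈ (G.SR ∪ G.trap)ᶜ := by
    rintro (h | h)
    exacts [hs.2 h, not_mem_trap_of_mem_potentiallyWinning hs.1 h]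
  have := (G.expectedTime_le π₁ π₂ hsD).trans_lt
    (tsum_measure_state_lt_top _ _ _ hθ ENNReal.ofNat_ne_top (hν π₂ G.s₀) hkl)
  exact this.ne h

end ICGame

/-! ### Upper bound for the divergence -/

lemma klFun_le_one_add {x y : ℝ} (hx : 0 < x) (hy : Real.log x ≤ y) :
    InformationTheory.klFun x ≤ 1 + x * y := by
  rw [InformationTheory.klFun]
  have := mul_le_mul_of_nonneg_left hy hx.le
  linarith

/-- If the density of `μ` with respect to `ν` is at most `c ^ n` on the event `E n`, where `n` is
bounded by an integrable function `N` that is infinite outside of these events, then the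
Kullback–Leibler divergence is finite. -/
lemma klDiv_lt_top_of_le_pow_mul {Ω : Type*} [MeasurableSpace Ω] (μ ν : Measure Ω)
    [IsProbabilityMeasure μ] [IsProbabilityMeasure ν] {E : ℕ → Set Ω}
    (hE : ∀ n, MeasurableSet (E n)) {N : Ω → ℝ≥0∞} (hN : Measurable N) {c : ℝ} (hc : 1 < c)
    (hμν : ∀ n A, MeasurableSet A → μ (A ∩ E n) ≤ ENNReal.ofReal c ^ n * ν (A ∩ E n))
    (hEN : ∀ n, ∀ ω ∈ E n, (n : ℝ≥0∞) ≤ N ω) (hN' : ∀ ω, (∀ n, ω ∉ E n) → N ω = ∞)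
    (hint : ∫⁻ ω, N ω ∂μ ≠ ∞) : InformationTheory.klDiv μ ν < ∞ := by
  -- `N` is integrable, hence almost surely finite, while it is infinite off the events.
  have hcover : μ (⋃ n, E n)ᶜ = 0 := by
    refine measure_mono_null (fun ω hω => ?_) (ae_iff.1 (ae_lt_top hN hint))
    simp only [Set.mem_compl_iff, Set.mem_iUnion, not_exists] at hω
    simp [hN' ω hω]
  have hac : μ ≪ ν := by
    refine Measure.AbsolutelyContinuous.mk fun A hA hνA => ?_
    have hsub : A ⊆ (⋃ n, A ∩ E n) ∪ (⋃ n, E n)ᶜ := by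
      rw [← Set.inter_iUnion]
      intro ω hω
      by_cases h : ω ∈ ⋃ n, E n
      exacts [Or.inl ⟨hω, h⟩, Or.inr h]
    refine measure_mono_null hsub (measure_union_null (measure_iUnion_null fun n => ?_) hcover)
    refine le_antisymm ((hμν n A hA).trans_eq ?_) zero_le
    rw [measure_mono_null Set.inter_subset_left hνA, mul_zero]
  have hdens : ∀ n, ∀ᵐ ω ∂ν, ω ∈ E n → μ.rnDeriv ν ω ≤ ENNReal.ofReal c ^ n := by
    intro n
    rw [← ae_restrict_iff' (hE n)]
    refine ae_le_of_forall_setLIntegral_le_of_sigmaFinite (μ.measurable_rnDeriv ν) ?_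
    intro A hA _
    rw [Measure.restrict_restrict hA, setLIntegral_const, Measure.setLIntegral_rnDeriv hac]
    exact hμν n A hA
  have hlog : 0 < Real.log c := Real.log_pos hc
  rw [InformationTheory.klDiv_eq_lintegral_klFun_of_ac hac]
  have hle : ∫⁻ ω, ENNReal.ofReal (InformationTheory.klFun (μ.rnDeriv ν ω).toReal) ∂ν ≤
      ∫⁻ ω, 1 + μ.rnDeriv ν ω * (ENNReal.ofReal (Real.log c) * N ω) ∂ν := by
    refine lintegral_mono_ae ?_
    filter_upwards [μ.rnDeriv_lt_top ν, ae_all_iff.2 hdens] with ω hω hd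
    by_cases h0 : μ.rnDeriv ν ω = 0
    · simp [h0, InformationTheory.klFun]
    have hpos : 0 < (μ.rnDeriv ν ω).toReal := ENNReal.toReal_pos h0 hω.ne
    by_cases hn : ∃ n, ω ∈ E n
    · obtain ⟨n, hn⟩ := hn
      have h1 : (μ.rnDeriv ν ω).toReal ≤ c ^ n := by
        refine ENNReal.toReal_le_of_le_ofReal (by positivity) ((hd n hn).trans_eq ?_)
        rw [ENNReal.ofReal_pow (by linarith)]
      have h2 : Real.log (μ.rnDeriv ν ω).toReal ≤ Real.log c * n := by
        rw [mul_comm, ← Real.log_pow]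
        exact Real.log_le_log hpos h1
      calc ENNReal.ofReal (InformationTheory.klFun (μ.rnDeriv ν ω).toReal)
          ≤ ENNReal.ofReal (1 + (μ.rnDeriv ν ω).toReal * (Real.log c * n)) :=
            ENNReal.ofReal_le_ofReal (klFun_le_one_add hpos h2)
        _ = 1 + μ.rnDeriv ν ω * (ENNReal.ofReal (Real.log c) * n) := by
            rw [ENNReal.ofReal_add zero_le_one (by positivity), ENNReal.ofReal_one,
              ENNReal.ofReal_mul hpos.le, ENNReal.ofReal_toReal hω.ne, ENNReal.ofReal_mul hlog.le,
              ENNReal.ofReal_natCast]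
        _ ≤ _ := by
            gcongr
            exact hEN n ω hn
    · push Not at hn
      rw [hN' ω hn, ENNReal.mul_top (by simpa using hlog), ENNReal.mul_top h0, add_top]
      exact le_top
  refine hle.trans_lt ?_
  rw [lintegral_add_left measurable_const, lintegral_rnDeriv_mul hac (hN.const_mul _).aemeasurable,
    lintegral_const_mul _ hN]
  simp only [lintegral_const, measure_univ, mul_one]
  exact ENNReal.add_lt_top.2 ⟨ENNReal.one_lt_top,
    ENNReal.mul_lt_top ENNReal.ofReal_lt_top hint.lt_top⟩

lemma exists_pmf_support_eq {α : Type*} [Finite α] {s : Set α} (hs : s.Nonempty) :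
    ∃ p : PMF α, p.support = s := by
  classical
  refine ⟨PMF.uniformOfFinset s.toFinite.toFinset (by simpa using hs), ?_⟩
  ext x
  simp

lemma GamePolicy.ext_act {S A B C : Type*} {avail : S → Set C} {π π' : GamePolicy S A B avail}
    (h : ∀ past s, π.act past s = π'.act past s) : π = π' := by
  obtain ⟨act, _⟩ := π
  obtain ⟨act', _⟩ := π'
  obtain rfl : act = act' := funext₂ h
  rfl

/-! ### The likelihood ratio up to the first win -/

/-- The runs that visit `C` for the first time at time `n`. -/
def firstVisit {S A B : Type*} (C : Set S) (n : ℕ) : Set (ℕ → GameStep S A B) :=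
  {γ | (γ n).state ∈ C ∧ ∀ k < n, (γ k).state ∉ C}

lemma measurableSet_firstVisit {S A B : Type*} (C : Set S) (n : ℕ) :
    MeasurableSet (firstVisit C n : Set (ℕ → GameStep S A B)) := by
  have : (firstVisit C n : Set (ℕ → GameStep S A B)) =
      {γ | (γ n).state ∈ C} ∩ ⋂ k, ⋂ (_ : k < n), {γ | (γ k).state ∈ Cᶜ} := by
    ext γ
    simp [firstVisit]
  rw [this]
  exact (ICGame.measurableSet_state C n).inter
    (MeasurableSet.iInter fun k => MeasurableSet.iInter fun _ => ICGame.measurableSet_state Cᶜ k)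

lemma exists_mem_firstVisit {S A B : Type*} {C : Set S} {γ : ℕ → GameStep S A B} {t : ℕ}
    (h : (γ t).state ∈ C) : ∃ n, γ ∈ firstVisit C n := by
  classical
  have hex : ∃ t, (γ t).state ∈ C := ⟨t, h⟩
  exact ⟨Nat.find hex, Nat.find_spec hex, fun k hk => Nat.find_min hex hk⟩

lemma preimage_consRun_firstVisit_zero {S A B : Type*} {C : Set S} {x : GameStep S A B}
    (hx : x.state ∉ C) : consRun x ⁻¹' firstVisit C 0 = ∅ := by
  ext γ
  simp [firstVisit, hx]

lemma preimage_consRun_firstVisit_succ {S A B : Type*} {C : Set S} {x : GameStep S A B}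
    (hx : x.state ∉ C) (n : ℕ) : consRun x ⁻¹' firstVisit C (n + 1) = firstVisit C n := by
  ext γ
  constructor
  · exact fun h => ⟨h.1, fun k hk => h.2 (k + 1) (by omega)⟩
  · refine fun h => ⟨h.1, fun k hk => ?_⟩
    cases k with
    | zero => exact hx
    | succ k => exact h.2 k (by omega)

namespace ICGame

variable {S A B : Type*} (G : ICGame S A B)

open Classical in
/-- The policy that plays according to `σ` until a winning state is visited, and like the average
player from then on. -/
noncomputable def winThenAverage (σ : S → PMF A) (hσ : ∀ s, (σ s).support ⊆ G.A1 s) :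
    G.Policy1 where
  -- Winning states absorb, so the clause on `past` is redundant along actual runs; it makes the
  -- continuation after a win equal to `avPolicy` on all histories.
  act past s := if s ∈ G.SR ∨ ∃ x ∈ past, x.state ∈ G.SR then G.av s else σ s
  act_mem past s := by
    split_ifs
    exacts [G.av_mem s, hσ s]

variable {G} {σ : S → PMF A} {hσ : ∀ s, (σ s).support ⊆ G.A1 s}

lemma winThenAverage_act_of_mem {s : S} (hs : s ∈ G.SR) :
    (G.winThenAverage σ hσ).act [] s = G.av s :=
  if_pos (Or.inl hs)

lemma winThenAverage_act_of_not_mem {s : S} (hs : s ∉ G.SR) :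
    (G.winThenAverage σ hσ).act [] s = σ s :=
  if_neg (by simpa using hs)

lemma winThenAverage_after_of_mem {x : GameStep S A B} (hx : x.state ∈ G.SR) :
    (G.winThenAverage σ hσ).after x = G.avPolicy :=
  GamePolicy.ext_act fun _ _ => if_pos (Or.inr ⟨x, List.mem_cons_self, hx⟩)

lemma winThenAverage_after_of_not_mem {x : GameStep S A B} (hx : x.state ∉ G.SR) :
    (G.winThenAverage σ hσ).after x = G.winThenAverage σ hσ := by
  refine GamePolicy.ext_act fun past s => ?_
  have h : (∃ y ∈ x :: past, y.state ∈ G.SR) ↔ ∃ y ∈ past, y.state ∈ G.SR := by simp [hx]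
  classical exact if_congr (or_congr_right h) rfl rfl

variable (G) in
lemma exists_mul_av_ge [Finite S] [Finite A] (hG : G.AllPermissible) :
    ∃ c : ℝ, 1 < c ∧ ∀ s, ∀ a ∈ G.A1 s, 1 ≤ ENNReal.ofReal c * G.av s a := by
  obtain ⟨p, hp0, hp1, hp⟩ := exists_pos_le_of_pos fun i : S × A => (G.av i.1 i.2).toReal
  -- `1 / p` already bounds the one-step likelihood ratio; the added 1 makes `c > 1` strict, so that
  -- `log c > 0`.
  have hc : 1 < 1 / p + 1 := by
    have : 0 < 1 / p := by positivity
    linarith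
  refine ⟨1 / p + 1, hc, fun s a ha => ?_⟩
  have htop := PMF.apply_ne_top (G.av s) a
  have h := hp (s, a) (ENNReal.toReal_pos (hG s a ha).ne' htop)
  rw [← ENNReal.ofReal_toReal htop, ← ENNReal.ofReal_mul (by linarith), ENNReal.one_le_ofReal]
  calc (1 : ℝ) ≤ (1 / p + 1) * p := by
        rw [add_mul, one_div_mul_cancel hp0.ne']
        linarith
    _ ≤ _ := by gcongr

variable [Finite S] [Finite A] [Finite B]

lemma runLaw_winThenAverage_of_mem (π₂ : G.Policy2) {s : S} (hs : s ∈ G.SR) :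
    G.runLaw (G.winThenAverage σ hσ) π₂ s = G.runLaw G.avPolicy π₂ s := by
  rw [runLaw_eq_sum, runLaw_eq_sum]
  congr 1
  funext i
  simp only [stepWeight, tailLaw, winThenAverage_act_of_mem hs, avPolicy_act, avPolicy_after]
  rw [winThenAverage_after_of_mem (x := ⟨s, i.1, i.2.1⟩) hs]

/-- Each step before the win costs one factor `c`; from the win on the two laws coincide. -/
lemma runLaw_winThenAverage_inter_firstVisit_le {c : ℝ≥0∞} (hc : 1 ≤ c)
    (hσc : ∀ s a, σ s a ≤ c * G.av s a) (n : ℕ) {E : Set (ℕ → GameStep S A B)}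
    (hE : MeasurableSet E) (π₂ : G.Policy2) (s : S) :
    G.runLaw (G.winThenAverage σ hσ) π₂ s (E ∩ firstVisit G.SR n) ≤
      c ^ n * G.runLaw G.avPolicy π₂ s (E ∩ firstVisit G.SR n) := by
  induction n generalizing E π₂ s with
  | zero =>
    by_cases hs : s ∈ G.SR
    · rw [runLaw_winThenAverage_of_mem π₂ hs, pow_zero, one_mul]
    · refine le_of_eq_of_le ?_ zero_le
      rw [runLaw_eq_zero_iff _ _ _ _ (hE.inter (measurableSet_firstVisit _ _))]
      intro i _
      rw [Set.preimage_inter, preimage_consRun_firstVisit_zero hs, Set.inter_empty, measure_empty]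
  | succ n ih =>
    by_cases hs : s ∈ G.SR
    · rw [runLaw_winThenAverage_of_mem π₂ hs]
      exact le_mul_of_one_le_left zero_le (one_le_pow₀ hc)
    · rw [runLaw_apply _ _ _ _ (hE.inter (measurableSet_firstVisit _ _)),
        runLaw_apply _ _ _ _ (hE.inter (measurableSet_firstVisit _ _)), ← ENNReal.tsum_mul_left]
      refine ENNReal.tsum_le_tsum fun i => ?_
      rw [Set.preimage_inter, preimage_consRun_firstVisit_succ hs]
      have h1 : G.stepWeight (G.winThenAverage σ hσ) π₂ s i ≤
          c * G.stepWeight G.avPolicy π₂ s i := by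
        simp only [stepWeight, winThenAverage_act_of_not_mem hs, avPolicy_act, ← mul_assoc]
        gcongr
        exact hσc s i.1
      have h2 := ih (measurable_consRun (⟨s, i.1, i.2.1⟩ : GameStep S A B) hE)
        (π₂.after ⟨s, i.1, i.2.1⟩) i.2.2
      rw [tailLaw, tailLaw, winThenAverage_after_of_not_mem (x := ⟨s, i.1, i.2.1⟩) hs]
      refine (mul_le_mul' h1 h2).trans_eq ?_
      rw [avPolicy_after]
      ring

/-! ### The policy of part (1) -/

variable (G)

/-- Full support on the stay actions turns the mere existence of an escaping action into a positive
probability of escape. -/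
lemma exists_stayPolicy : ∃ σ : S → PMF A, (∀ s, (σ s).support ⊆ G.A1 s) ∧
    ∀ s ∈ G.potentiallyWinning \ G.SR, (σ s).support = G.stayActions s := by
  have : ∀ s, ∃ p : PMF A, p.support ⊆ G.A1 s ∧
      (s ∈ G.potentiallyWinning \ G.SR → p.support = G.stayActions s) := by
    intro s
    by_cases hs : s ∈ G.potentiallyWinning \ G.SR
    · obtain ⟨p, hp⟩ := exists_pmf_support_eq (stayActions_nonempty hs.1 hs.2)
      exact ⟨p, hp ▸ fun a ha => ha.1, fun _ => hp⟩
    · exact ⟨G.av s, G.av_mem s, fun h => absurd h hs⟩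
  choose σ h1 h2 using this
  exact ⟨σ, h1, h2⟩

/-- From a potentially winning state, Player 1 has a policy that plays like the average player once
it has won and whose time to win has an exponential moment, against every policy of Player 2. -/
lemma exists_winThenAverage_lintegral_pow_visits_le :
    ∃ (σ : S → PMF A) (hσ : ∀ s, (σ s).support ⊆ G.A1 s) (θ : ℝ), 1 < θ ∧
      ∀ s ∈ G.potentiallyWinning, ∀ (π₂ : G.Policy2) (T : ℕ),
        ∫⁻ γ, ENNReal.ofReal θ ^ visits G.SRᶜ T γ ∂G.runLaw (G.winThenAverage σ hσ) π₂ s ≤ 2 := by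
  classical
  obtain ⟨σ, hσ, hstay⟩ := G.exists_stayPolicy
  obtain ⟨θ, hθ, h, h1, h2, -, hdrift⟩ := exists_drift G.A2
    (fun s b => (σ s).bind fun a => G.P s a b) (T := G.SR) (D := G.potentiallyWinning \ G.SR)
    Set.disjoint_sdiff_right (by
      intro Z hZ hne
      obtain ⟨s, hs, hb⟩ := exists_stayActions_escape hne hZ
      refine ⟨s, hs, fun b hbs => ?_⟩
      obtain ⟨a, ha, s', hs', hZ'⟩ := hb b hbs
      refine ⟨s', (PMF.mem_support_bind_iff _ _ _).2 ⟨a, hstay s (hZ hs) ▸ ha, hs'⟩, ?_⟩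
      by_cases hSR : s' ∈ G.SR
      · exact Or.inl hSR
      · exact Or.inr ⟨⟨ha.2 b hbs s' hs', hSR⟩, hZ'⟩)
  refine ⟨σ, hσ, θ, hθ, fun s hs π₂ T => (G.lintegral_pow_visits_le (ENNReal.ofReal θ) _ h h1
    -- The invariant confines the play to `S⁺` until it wins, so all time in `SRᶜ` is spent where
    -- the drift condition holds.
    (fun π₁ s => (π₁ = G.winThenAverage σ hσ ∧ s ∈ G.potentiallyWinning \ G.SR) ∨
      (s ∈ G.SR ∧ (π₁ = G.winThenAverage σ hσ ∨ π₁ = G.avPolicy))) ?_ ?_ T π₂ ?_).trans (h2 s)⟩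
  · rintro π₁ s (⟨rfl, hs⟩ | ⟨hs, -⟩) b hb
    · rw [if_pos (show s ∈ G.SRᶜ from hs.2), winThenAverage_act_of_not_mem hs.2]
      refine le_trans (le_of_eq ?_) (hdrift s hs b hb)
      rw [tsum_bind_mul]
    · rw [if_neg (show s ∉ G.SRᶜ from fun h => h hs), one_mul, tsum_step_of_mem_SR _ hs hb]
  · rintro π₁ s (⟨rfl, hs⟩ | ⟨hs, hπ⟩) a ha b hb s' hs'
    · rw [winThenAverage_act_of_not_mem hs.2, hstay s hs] at ha
      rw [winThenAverage_after_of_not_mem (x := ⟨s, a, b⟩) hs.2]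
      by_cases hSR : s' ∈ G.SR
      · exact Or.inr ⟨hSR, Or.inl rfl⟩
      · exact Or.inl ⟨rfl, ha.2 b hb s' hs', hSR⟩
    · rw [G.absorbing s hs a (π₁.act_mem _ _ ha) b hb, PMF.support_pure,
        Set.mem_singleton_iff] at hs'
      subst hs'
      refine Or.inr ⟨hs, Or.inr ?_⟩
      rcases hπ with rfl | rfl
      exacts [winThenAverage_after_of_mem (x := ⟨s', a, b⟩) hs, rfl]
  · by_cases hSR : s ∈ G.SR
    · exact Or.inr ⟨hSR, Or.inl rfl⟩
    · exact Or.inl ⟨rfl, hs, hSR⟩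

theorem exists_policy_klObjective_lt_top (hG : G.AllPermissible)
    (hs₀ : G.s₀ ∈ G.potentiallyWinning) :
    ∃ π₁ : G.Policy1, ∀ π₂ : G.Policy2, G.klObjective π₁ π₂ < ∞ ∧
      ∀ s ∈ G.potentiallyWinning \ G.SR, G.expectedTime π₁ π₂ s < ∞ := by
  obtain ⟨σ, hσ, θ, hθ, hexp⟩ := G.exists_winThenAverage_lintegral_pow_visits_le
  obtain ⟨c, hc, hav⟩ := G.exists_mul_av_ge hG
  refine ⟨G.winThenAverage σ hσ, fun π₂ => ?_⟩
  have htime : ∑' t, G.runLaw (G.winThenAverage σ hσ) π₂ G.s₀ {γ | (γ t).state ∈ G.SRᶜ} < ∞ :=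
    tsum_measure_state_lt_top _ _ _ hθ ENNReal.ofNat_ne_top (hexp G.s₀ hs₀ π₂)
      (by rw [InformationTheory.klDiv_self]; exact ENNReal.zero_ne_top)
  refine ⟨?_, fun s hs => (G.expectedTime_le _ _ hs.2).trans_lt htime⟩
  have hσc : ∀ s a, σ s a ≤ ENNReal.ofReal c * G.av s a := by
    intro s a
    by_cases ha : σ s a = 0
    · simp [ha]
    · exact (PMF.coe_le_one _ _).trans (hav s a (hσ s ((PMF.mem_support_iff _ _).2 ha)))
  have hind : ∀ t, Measurable
      (Set.indicator {γ : ℕ → GameStep S A B | (γ t).state ∈ G.SRᶜ}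
        (1 : (ℕ → GameStep S A B) → ℝ≥0∞)) :=
    fun t => measurable_one.indicator (measurableSet_state _ t)
  -- `N` is the total time outside the winning states: at least `n` if the first win is at time `n`,
  -- and infinite without a win.
  refine klDiv_lt_top_of_le_pow_mul _ _ (measurableSet_firstVisit G.SR)
    (N := fun γ => ∑' t, Set.indicator {γ | (γ t).state ∈ G.SRᶜ} 1 γ)
    (Measurable.tsum hind) hc
    (fun n E hE => runLaw_winThenAverage_inter_firstVisit_le (ENNReal.one_le_ofReal.2 hc.le) hσc n
      hE π₂ G.s₀) ?_ ?_ ?_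
  · intro n γ hγ
    calc (n : ℝ≥0∞) = ∑ t ∈ Finset.range n, Set.indicator {γ | (γ t).state ∈ G.SRᶜ} 1 γ := by
          rw [Finset.sum_congr rfl fun t ht => Set.indicator_of_mem
            (show γ ∈ {γ | (γ t).state ∈ G.SRᶜ} from hγ.2 t (Finset.mem_range.1 ht)) 1]
          simp
      _ ≤ _ := ENNReal.sum_le_tsum _
  · intro γ hγ
    have : ∀ t, Set.indicator {γ : ℕ → GameStep S A B | (γ t).state ∈ G.SRᶜ}
        (1 : (ℕ → GameStep S A B) → ℝ≥0∞) γ = 1 := fun t =>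
      Set.indicator_of_mem
        (show γ ∈ {γ | (γ t).state ∈ G.SRᶜ} from fun ht => (exists_mem_firstVisit ht).elim hγ) 1
    simp_rw [this]
    exact ENNReal.tsum_const_eq_top_of_ne_zero one_ne_zero
  · rw [lintegral_tsum fun t => (hind t).aemeasurable]
    simp_rw [lintegral_indicator_one (measurableSet_state _ _)]
    exact htime.ne

end ICGame

theorem proposition1 {S A B : Type*} [Finite S] [Finite A] [Finite B] (G : ICGame S A B) :
    (G.AllPermissible → G.s₀ ∈ G.potentiallyWinning →
      ∃ π₁fin : G.Policy1, ∀ π₂ : G.Policy2,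
        G.klObjective π₁fin π₂ < ∞ ∧
        ∀ s ∈ G.potentiallyWinning \ G.SR, G.expectedTime π₁fin π₂ s < ∞) ∧
    (∀ (π₁inf : G.Policy1) (π₂ : G.Policy2),
      (∃ s ∈ G.potentiallyWinning \ G.SR, G.expectedTime π₁inf π₂ s = ∞) →
        G.klObjective π₁inf π₂ = ∞) :=
  ⟨G.exists_policy_klObjective_lt_top,
    fun _ _ ⟨_, hs, h⟩ => G.klObjective_eq_top_of_expectedTime_eq_top hs h⟩
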